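/- Let $p,q\ge 0$ with $p+q=1$ and $q\le p$, let $\gamma\in[0,1]$ and let $n_1\ge 1$ be an integer. Blocks are mined one after another on top of a genesis block; each block is, independently of the others, mined by the attacker (letter S) with probability $q$ and by the honest miners (letter H) with probability $p$. The attacker follows Strategy 1, in successive attack cycles. At the start of a cycle everybody agrees on the last official block. During the cycle the attacker mines on a fork of his own growing from that block. The first honest block of the cycle is built on the last official block. After each honest block that does not end the cycle, the attacker publishes the part of his fork up to the height of the honest chain, so that two public branches of the same height compete; if the next block is honest, it is built on the last published block of the attacker with probability $\gamma$, and on the last honest block with probability $1-\gamma$, independently of everything else. The cycle ends as soon as, in this cycle, either the honest chain is longer than the attacker's fork (then the last honest block becomes the last official block), or there is at least one honest block and the attacker's fork is exactly one block longer than the honest chain (then the attacker publishes his whole fork and its last block becomes the last official block). Thus the cycles are H, SHS, SHH, and the words SS$w$H with $w$ a Dyck word in S (up) and H (down). An uncle is a block which does not belong to the official blockchain, but whose parent does. A block $N$ can refer to an older block $U$ if $U$ is not on the chain ending at $N$, the parent of $U$ is, and the distance $d=\operatorname{height}(N)-\operatorname{height}(U)$ satisfies $1\le d\le n_1$. Every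 block, whoever mines it, refers to all the blocks it can refer to and to which no earlier block of its chain has already referred (there is no bound on the number of blocks to which one block refers). A nephew of an uncle is an official block which refers to it. For an attack cycle, let $V$ be the number of uncles which are created in this cycle and are referred to by a nephew mined in a strictly later attack cycle. Then, for every cycle (the first, the second, and so on), $V$ is integrable and $$\mathbb{E}[V]=\frac{q^2}{p}\,\bigl(1-q^{n_1-1}\bigr)\,\gamma+(1-\gamma)\,p\,q^2\,\frac{1-(pq)^{n_1-1}}{1-pq}.$$ -/

import Mathlib

namespace SelfishMining

open MeasureTheory

/-! ## The random input -/

/-- The miner of a block: the attacker (letter `S`) or the honest miners (letter `H`). -/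
inductive Miner where
  | selfish
  | honest
  deriving DecidableEq

instance : MeasurableSpace Miner := ⊤

/-- The randomness of one mined block: who mines it, and a switch saying whether the honest miners,
if they mine it during a competition between two public branches of the same height, build on the
attacker's branch (`true`) or on the honest branch (`false`). -/
abbrev Draw := Miner × Bool

/-- The law with mass `r` at `a` and mass `1 - r` at `b`. -/
noncomputable def twoPoint {α : Type*} [MeasurableSpace α] (r : ℝ) (a b : α) : Measure α :=
  ENNReal.ofReal r • Measure.dirac a + ENNReal.ofReal (1 - r) • Measure.dirac b

/-- A block belongs to the attacker with probability `q`; independently, the switch is `true` with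
probability `γ`. -/
noncomputable def drawLaw (q γ : ℝ) : Measure Draw :=
  (twoPoint q Miner.selfish Miner.honest).prod (twoPoint γ true false)

/-- The law of the whole history: independent draws, one for each mined block. -/
noncomputable def historyLaw (q γ : ℝ) : Measure (ℕ → Draw) :=
  Measure.infinitePi fun _ : ℕ => drawLaw q γ

/-! ## The attack: where blocks are mined and when attack cycles end

Block `0` is the genesis block, and block `n + 1` is the block mined at step `n`, i.e. the one
produced by the draw `ω n`. -/

/-- The situation of the network between two blocks. -/
structure State where
  /-- number of attack cycles already completed, i.e. the index of the current one -/
  cycle : ℕ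
  /-- last block of the official blockchain when the current cycle started -/
  base : ℕ
  /-- blocks mined by the attacker in the current cycle, oldest first; they form a branch
  growing from `base` -/
  fork : List ℕ
  /-- blocks mined by the honest miners in the current cycle, oldest first; the `j`-th one
  has height `j` above `base` -/
  pub : List ℕ

/-- The parent of the next block. The attacker always extends his own fork. The first honest block
of a cycle is built on `base`. Afterwards, if there are `h` honest blocks in the (unfinished) cycle,
the attacker has published the first `h` blocks of his fork, so that two public branches of the
same height compete: the honest miners build either on the `h`-th block of the fork, or on the
last honest block. -/
def nextParent (s : State) : Draw → ℕ
  | (Miner.selfish, _) => s.fork.getLastD s.base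
  | (Miner.honest, onFork) =>
      if s.pub = [] then s.base
      else if onFork then s.fork.getD (s.pub.length - 1) s.base
      else s.pub.getLastD s.base

/-- What happens once the new block has been added to `fork` or `pub`.
* If the honest public chain is longer than the attacker's fork, the attacker gives up: the cycle
  ends and the last honest block is official.
* If there is an honest block in the cycle and the fork is longer by exactly one block, the attacker
  publishes his whole fork: the cycle ends and the last block of the fork is official.
* Otherwise the cycle goes on; the attacker has published the part of his fork having the height of
  the honest chain, and keeps the rest secret. -/
def settle (s : State) : State :=
  if s.fork.length < s.pub.length then
    { cycle := s.cycle + 1, base := s.pub.getLastD s.base, fork := [], pub := [] }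
  else if s.pub ≠ [] ∧ s.fork.length = s.pub.length + 1 then
    { cycle := s.cycle + 1, base := s.fork.getLastD s.base, fork := [], pub := [] }
  else s

/-- One step: block number `b` is mined, with draw `x`. -/
def step (s : State) (b : ℕ) (x : Draw) : State :=
  match x.1 with
  | Miner.selfish => settle { s with fork := s.fork ++ [b] }
  | Miner.honest => settle { s with pub := s.pub ++ [b] }

/-- The state after `n` mined blocks. -/
def state (ω : ℕ → Draw) : ℕ → State
  | 0 => { cycle := 0, base := 0, fork := [], pub := [] }
  | n + 1 => step (state ω n) (n + 1) (ω n)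

/-- The parent of a block (with the convention that the genesis block is its own parent). -/
def parent (ω : ℕ → Draw) : ℕ → ℕ
  | 0 => 0
  | n + 1 => nextParent (state ω n) (ω n)

/-- The index of the attack cycle during which block `b ≥ 1` is mined. -/
def cycleOf (ω : ℕ → Draw) (b : ℕ) : ℕ := (state ω (b - 1)).cycle

/-! ## The tree of blocks -/

/-- `a` belongs to the chain that ends at `b` (`a = b` allowed). -/
def OnChain (ω : ℕ → Draw) (a b : ℕ) : Prop := ∃ j : ℕ, (parent ω)^[j] b = a

/-- The height of a block: the number of steps to the genesis block. -/
noncomputable def height (ω : ℕ → Draw) (b : ℕ) : ℕ := sInf {j : ℕ | (parent ω)^[j] b = 0}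

/-- The official blocks: those on the chain that is official at the end of some attack cycle
(or the genesis block). -/
def Official (ω : ℕ → Draw) (b : ℕ) : Prop := ∃ n : ℕ, OnChain ω b (state ω n).base

/-- An uncle: an orphan (i.e. not official) block whose parent is official. -/
def Uncle (ω : ℕ → Draw) (b : ℕ) : Prop := ¬ Official ω b ∧ Official ω (parent ω b)

/-! ## References -/

/-- The protocol allows block `N` to refer to the older block `U` if `U` is not on the chain of `N`,
the parent of `U` is, and the distance, i.e. the difference of heights, is between `1` and `n₁`.
(A secret block of the attacker is at least as high as every honest block mined before its
publication; so honest blocks are never eligible to refer to a secret block.) -/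
def Eligible (n₁ : ℕ) (ω : ℕ → Draw) (N U : ℕ) : Prop :=
  U < N ∧ ¬ OnChain ω U N ∧ OnChain ω (parent ω U) N ∧
    height ω U < height ω N ∧ height ω N ≤ height ω U + n₁

/-- All blocks, honest or not, refer to everything they can: `N` refers to `U` if it is eligible to
do so and if no earlier block on the chain of `N` has already referred to `U`. -/
def Refers (n₁ : ℕ) (ω : ℕ → Draw) (N U : ℕ) : Prop :=
  Eligible n₁ ω N U ∧ ∀ M : ℕ, M < N → OnChain ω M N → ¬ Refers n₁ ω M U
termination_by N

/-- `V`, for the cycle number `k`: the number of uncles that are created in this cycle and that are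
referred to by a nephew, i.e. by an official block, mined in a strictly later cycle. -/
noncomputable def V (n₁ k : ℕ) (ω : ℕ → Draw) : ℕ :=
  Set.ncard {U : ℕ | U ≠ 0 ∧ cycleOf ω U = k ∧ Uncle ω U ∧
    ∃ N : ℕ, Official ω N ∧ k < cycleOf ω N ∧ Refers n₁ ω N U}

end SelfishMining

namespace SelfishMining

open MeasureTheory

open ProbabilityTheory

open scoped ENNReal

/-! Combinatorial half. Suppose an official block M of a cycle is younger and higher than an uncle U
of that cycle whose parent is on the chain of M. If a later block of that chain were close enough to
refer to U, then so was M, so the reference has already been made (`Refers.false_of_between`). When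
a cycle ends with its last mined block official, that block is higher than all others of the cycle
and plays the role of M, so nothing is left for later cycles. Otherwise an honest block ends the
cycle and the attacker's last block B becomes official. B disposes of the uncles older than B, and
only the honest blocks mined after B remain. The m-th of them from the end was mined under a lead of
m + 1. It lies at distance m + 1 from the first official block above B, and it is an uncle exactly
when its parent is the base of the cycle or an attacker's block. Thus V almost surely counts the
steps satisfying `TailBlock` with 1 ≤ m ≤ n₁ - 1 (`exists_tailBlock`, `TailBlock.mem_uncles`,
`V_eq_ncard`).

Probabilistic half. By linearity, it suffices to know how often, on average, the lead equals m + 1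
in cycle k. These expected numbers of visits satisfy first-step equations. `green_function` solves
them using only nonnegativity and the fact that the probability of reaching the next cycle is at
most 1; it also shows that this probability is 1, even when p = q (`visits_values`). A lead of m + 1
followed by m honest blocks has expected number q ^ (m + 1), of which q ^ (m + 1) * p ^ m comes from
times without an earlier honest block. The rest counts with weight γ (`tsum_tailBlock`), and summing
over m gives two geometric series. -/

/-! ### Live blocks -/

/-- The blocks which can be the parent of a later block. -/
def live (s : State) : Set ℕ := {b | b = s.base ∨ b ∈ s.fork ∨ b ∈ s.pub}

/-- The state after a new block has been mined and before it is settled. -/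
def addBlock (s : State) (b : ℕ) (x : Draw) : State :=
  match x.1 with
  | Miner.selfish => { s with fork := s.fork ++ [b] }
  | Miner.honest => { s with pub := s.pub ++ [b] }

theorem step_eq (s : State) (b : ℕ) (x : Draw) : step s b x = settle (addBlock s b x) := by
  rcases x with ⟨_ | _, _⟩ <;> rfl

theorem settle_cases (s : State) :
    (s.fork.length < s.pub.length ∧ settle s = ⟨s.cycle + 1, s.pub.getLastD s.base, [], []⟩) ∨
    ((s.pub ≠ [] ∧ s.fork.length = s.pub.length + 1) ∧
      settle s = ⟨s.cycle + 1, s.fork.getLastD s.base, [], []⟩) ∨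
    ((¬ s.fork.length < s.pub.length ∧ ¬ (s.pub ≠ [] ∧ s.fork.length = s.pub.length + 1)) ∧
      settle s = s) := by
  unfold settle
  split_ifs with h₁ h₂
  · exact Or.inl ⟨h₁, rfl⟩
  · exact Or.inr (Or.inl ⟨h₂, rfl⟩)
  · exact Or.inr (Or.inr ⟨⟨h₁, h₂⟩, rfl⟩)

theorem getLastD_eq_or_mem (l : List ℕ) (a : ℕ) : l.getLastD a = a ∨ l.getLastD a ∈ l := by
  simpa using List.getLastD_mem_cons (l := l) (a := a)

theorem getLastD_mem {l : List ℕ} (hl : l ≠ []) (a : ℕ) : l.getLastD a ∈ l := by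
  rw [List.getLastD_eq_getLast?, List.getLast?_eq_some_getLast hl]
  exact List.getLast_mem hl

theorem nextParent_mem_live (s : State) (x : Draw) : nextParent s x ∈ live s := by
  rcases x with ⟨_ | _, c⟩
  · rcases getLastD_eq_or_mem s.fork s.base with h | h
    · exact Or.inl h
    · exact Or.inr (Or.inl h)
  · unfold nextParent
    simp only
    split_ifs
    · exact Or.inl rfl
    · by_cases h : s.pub.length - 1 < s.fork.length
      · rw [List.getD_eq_getElem _ _ h]
        exact Or.inr (Or.inl (List.getElem_mem h))
      -- The index is out of range only for unreachable states; the default value is live anyway.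
      · rw [List.getD_eq_default _ _ (by omega)]
        exact Or.inl rfl
    · rcases getLastD_eq_or_mem s.pub s.base with h | h
      · exact Or.inl h
      · exact Or.inr (Or.inr h)

theorem live_addBlock {s : State} {b : ℕ} {x : Draw} {c : ℕ} (h : c ∈ live (addBlock s b x)) :
    c ∈ live s ∨ c = b := by
  rcases x with ⟨_ | _, _⟩ <;> simp [addBlock, live] at h ⊢ <;> tauto

theorem live_settle {s : State} {c : ℕ} (h : c ∈ live (settle s)) : c ∈ live s := by
  rcases settle_cases s with ⟨-, e⟩ | ⟨-, e⟩ | ⟨-, e⟩ <;> rw [e] at h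
  · simp only [live, List.not_mem_nil, or_self, or_false, Set.mem_ofPred_eq] at h
    rcases getLastD_eq_or_mem s.pub s.base with h' | h'
    · exact Or.inl (h.trans h')
    · exact Or.inr (Or.inr (h ▸ h'))
  · simp only [live, List.not_mem_nil, or_self, or_false, Set.mem_ofPred_eq] at h
    rcases getLastD_eq_or_mem s.fork s.base with h' | h'
    · exact Or.inl (h.trans h')
    · exact Or.inr (Or.inl (h ▸ h'))
  · exact h

/-- A block that has ceased to be live never becomes live again; the inductions along the history
rest on this. -/
theorem live_succ {ω : ℕ → Draw} {n c : ℕ} (h : c ∈ live (state ω (n + 1))) :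
    c ∈ live (state ω n) ∨ c = n + 1 := by
  rw [state, step_eq] at h
  exact live_addBlock (live_settle h)

theorem base_mem_live (s : State) : s.base ∈ live s := Or.inl rfl

theorem live_le {ω : ℕ → Draw} {n b : ℕ} (h : b ∈ live (state ω n)) : b ≤ n := by
  induction n with
  | zero => simpa [live, state] using h
  | succ n ih =>
    rcases live_succ h with h | h
    · exact (ih h).trans n.le_succ
    · exact h.le

/-! ### Chains and heights in the tree of blocks -/

theorem parent_lt (ω : ℕ → Draw) {b : ℕ} (hb : 0 < b) : parent ω b < b := by
  obtain ⟨n, rfl⟩ := Nat.exists_eq_succ_of_ne_zero hb.ne'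
  exact Nat.lt_succ_of_le (live_le (nextParent_mem_live _ _))

theorem parent_le (ω : ℕ → Draw) (b : ℕ) : parent ω b ≤ b := by
  rcases Nat.eq_zero_or_pos b with rfl | hb
  · exact le_rfl
  · exact (parent_lt ω hb).le

theorem OnChain.refl (ω : ℕ → Draw) (b : ℕ) : OnChain ω b b := ⟨0, rfl⟩

theorem OnChain.trans {ω : ℕ → Draw} {a b c : ℕ} (h₁ : OnChain ω a b) (h₂ : OnChain ω b c) :
    OnChain ω a c := by
  obtain ⟨i, rfl⟩ := h₁
  obtain ⟨j, rfl⟩ := h₂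
  exact ⟨i + j, Function.iterate_add_apply _ _ _ _⟩

theorem onChain_iff {ω : ℕ → Draw} {a b : ℕ} :
    OnChain ω a b ↔ a = b ∨ OnChain ω a (parent ω b) := by
  constructor
  · rintro ⟨_ | j, rfl⟩
    · exact Or.inl rfl
    · exact Or.inr ⟨j, rfl⟩
  · rintro (rfl | ⟨j, rfl⟩)
    · exact .refl _ _
    · exact ⟨j + 1, rfl⟩

theorem onChain_parent (ω : ℕ → Draw) (b : ℕ) : OnChain ω (parent ω b) b :=
  onChain_iff.2 (Or.inr (.refl _ _))

theorem OnChain.le {ω : ℕ → Draw} {a b : ℕ} (h : OnChain ω a b) : a ≤ b := by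
  obtain ⟨j, rfl⟩ := h
  induction j with
  | zero => exact le_rfl
  | succ j ih =>
    rw [Function.iterate_succ_apply']
    exact (parent_le _ _).trans ih

theorem OnChain.linear {ω : ℕ → Draw} {a b c : ℕ} (ha : OnChain ω a c) (hb : OnChain ω b c)
    (hab : a ≤ b) : OnChain ω a b := by
  obtain ⟨i, hi⟩ := ha
  obtain ⟨j, hj⟩ := hb
  rcases le_total j i with h | h
  · refine ⟨i - j, ?_⟩
    rw [← hj, ← Function.iterate_add_apply, Nat.sub_add_cancel h, hi]
  · have : OnChain ω b a := by
      refine ⟨j - i, ?_⟩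
      rw [← hi, ← Function.iterate_add_apply, Nat.sub_add_cancel h, hj]
    rw [hab.antisymm this.le]
    exact .refl _ _

theorem zero_onChain (ω : ℕ → Draw) (b : ℕ) : OnChain ω 0 b := by
  induction b using Nat.strong_induction_on with
  | _ b ih =>
    rcases Nat.eq_zero_or_pos b with rfl | hb
    · exact .refl _ _
    · exact (ih _ (parent_lt ω hb)).trans (onChain_parent ω b)

theorem height_of_pos (ω : ℕ → Draw) {b : ℕ} (hb : 0 < b) :
    height ω b = height ω (parent ω b) + 1 := by
  have h : 1 ≤ sInf {j : ℕ | (parent ω)^[j] b = 0} := by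
    rw [Nat.one_le_iff_ne_zero]
    intro h
    rcases Nat.sInf_eq_zero.1 h with h | h
    · exact hb.ne' h
    · obtain ⟨j, hj⟩ := zero_onChain ω b
      exact (Set.eq_empty_iff_forall_notMem.1 h) j hj
  -- The set defining the height of the parent is the one for `b` shifted by one; no element is lost
  -- since 0 is not in the latter.
  exact (Nat.sInf_add h).symm

theorem OnChain.height_lt {ω : ℕ → Draw} {a b : ℕ} (h : OnChain ω a b) (hab : a < b) :
    height ω a < height ω b := by
  induction b using Nat.strong_induction_on with
  | _ b ih =>
    rw [height_of_pos ω (show 0 < b by omega)]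
    rcases onChain_iff.1 h with h | h
    · exact absurd h hab.ne
    · rcases h.le.eq_or_lt with h' | h'
      · rw [← h']
        exact Nat.lt_succ_self _
      · exact (ih _ (parent_lt ω (by omega)) h h').trans (Nat.lt_succ_self _)

theorem OnChain.height_le {ω : ℕ → Draw} {a b : ℕ} (h : OnChain ω a b) :
    height ω a ≤ height ω b := by
  rcases h.le.eq_or_lt with rfl | h'
  · exact le_rfl
  · exact (h.height_lt h').le

/-- The first block above `a` on a chain that contains `a`. -/
theorem OnChain.exists_child {ω : ℕ → Draw} {a b : ℕ} (h : OnChain ω a b) (hab : a < b) :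
    ∃ c, OnChain ω c b ∧ parent ω c = a ∧ a < c := by
  induction b using Nat.strong_induction_on with
  | _ b ih =>
    rcases onChain_iff.1 h with h | h
    · omega
    · rcases h.le.eq_or_lt with h' | h'
      · exact ⟨b, .refl _ _, h'.symm, hab⟩
      · obtain ⟨c, hc, hp⟩ := ih _ (parent_lt ω (by omega)) h h'
        exact ⟨c, hc.trans (onChain_parent _ _), hp⟩

/-! ### Official blocks -/

theorem base_onChain_live {ω : ℕ → Draw} {n b : ℕ} (h : b ∈ live (state ω n)) :
    OnChain ω (state ω n).base b := by
  induction n generalizing b with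
  | zero =>
    obtain rfl : b = 0 := by simpa [live, state] using h
    exact .refl _ _
  | succ n ih =>
    have key : ∀ c, c ∈ live (addBlock (state ω n) (n + 1) (ω n)) →
        OnChain ω (state ω n).base c := by
      intro c hc
      rcases live_addBlock hc with hc | rfl
      · exact ih hc
      · exact (ih (nextParent_mem_live _ _)).trans (onChain_parent _ _)
    have hb : (addBlock (state ω n) (n + 1) (ω n)).base = (state ω n).base := by
      rcases ω n with ⟨_ | _, _⟩ <;> rfl
    rw [state, step_eq] at h ⊢
    rcases settle_cases (addBlock (state ω n) (n + 1) (ω n)) with ⟨-, e⟩ | ⟨-, e⟩ | ⟨-, e⟩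
    · rw [e] at h ⊢
      simp only [live, List.not_mem_nil, or_self, or_false, Set.mem_ofPred_eq] at h
      exact h ▸ .refl _ _
    · rw [e] at h ⊢
      simp only [live, List.not_mem_nil, or_self, or_false, Set.mem_ofPred_eq] at h
      exact h ▸ .refl _ _
    · rw [e] at h ⊢
      rw [hb]
      exact key b h

theorem base_onChain_base {ω : ℕ → Draw} {m n : ℕ} (h : m ≤ n) :
    OnChain ω (state ω m).base (state ω n).base := by
  induction n, h using Nat.le_induction with
  | base => exact .refl _ _
  | succ n _ ih =>
    refine ih.trans ?_
    rcases live_succ (base_mem_live (state ω (n + 1))) with h | h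
    · exact base_onChain_live h
    · rw [h]
      exact (base_onChain_live (nextParent_mem_live _ (ω n))).trans (onChain_parent ω (n + 1))

/-- At the start of a cycle only the base is live, so every later chain reaches the older blocks
through this base. -/
theorem onChain_base_of_live {ω : ℕ → Draw} {e n : ℕ} (hf : (state ω e).fork = [])
    (hp : (state ω e).pub = []) (hn : e ≤ n) {b c : ℕ} (hb : b ∈ live (state ω n)) (hc : c ≤ e)
    (hcb : OnChain ω c b) : OnChain ω c (state ω e).base := by
  induction n, hn using Nat.le_induction generalizing b with
  | base =>
    have : b = (state ω e).base := by simpa [live, hf, hp] using hb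
    exact this ▸ hcb
  | succ n hn ih =>
    rcases live_succ hb with h | rfl
    · exact ih h hcb
    · rcases onChain_iff.1 hcb with h | h
      · omega
      · exact ih (nextParent_mem_live _ (ω n)) h

/-- A block mined before the start of a cycle is official as soon as it is on the chain which is
official at that start. -/
theorem Official.onChain_base {ω : ℕ → Draw} {e c : ℕ} (hf : (state ω e).fork = [])
    (hp : (state ω e).pub = []) (h : Official ω c) (hc : c ≤ e) :
    OnChain ω c (state ω e).base := by
  obtain ⟨n, hn⟩ := h
  rcases le_total e n with h | h
  · exact onChain_base_of_live hf hp h (base_mem_live _) hc hn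
  · exact hn.trans (base_onChain_base h)

/-- `M` is no higher than `N`, so it also meets the distance bound and is eligible. Either `M` or an
earlier block of its chain has then made the reference, which forbids it to `N`. -/
theorem Refers.false_of_between {n₁ : ℕ} {ω : ℕ → Draw} {M N U : ℕ} (h : Refers n₁ ω N U)
    (hMN : OnChain ω M N) (hM : M < N) (hU : U < M) (hh : height ω U < height ω M)
    (hp : OnChain ω (parent ω U) M) : False := by
  rw [Refers] at h
  obtain ⟨⟨-, h₁, -, -, h₂⟩, h₃⟩ := h
  refine h₃ M hM hMN ?_
  rw [Refers]
  refine ⟨⟨hU, fun h => h₁ (h.trans hMN), hp, hh, hMN.height_le.trans h₂⟩, fun M' hM' h' => ?_⟩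
  exact h₃ M' (hM'.trans hM) (h'.trans hMN)

/-! ### The two branches of a cycle -/

/-- The blocks mined in the current cycle by a given miner. -/
def blocksOf (s : State) : Miner → List ℕ
  | Miner.selfish => s.fork
  | Miner.honest => s.pub

theorem mem_blocksOf_addBlock {s : State} {b c : ℕ} {x : Draw} {m : Miner} :
    b ∈ blocksOf (addBlock s c x) m ↔ b ∈ blocksOf s m ∨ (b = c ∧ x.1 = m) := by
  rcases x with ⟨_ | _, _⟩ <;> cases m <;> simp [addBlock, blocksOf]

theorem addBlock_cycle (s : State) (c : ℕ) (x : Draw) : (addBlock s c x).cycle = s.cycle := by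
  rcases x with ⟨_ | _, _⟩ <;> rfl

theorem addBlock_base (s : State) (c : ℕ) (x : Draw) : (addBlock s c x).base = s.base := by
  rcases x with ⟨_ | _, _⟩ <;> rfl

/-- After a block either the cycle goes on or a new cycle starts. -/
theorem state_succ_cases (ω : ℕ → Draw) (n : ℕ) :
    state ω (n + 1) = addBlock (state ω n) (n + 1) (ω n) ∨
    ((state ω (n + 1)).cycle = (state ω n).cycle + 1 ∧ (state ω (n + 1)).fork = [] ∧
      (state ω (n + 1)).pub = []) := by
  rw [state, step_eq]
  rcases settle_cases (addBlock (state ω n) (n + 1) (ω n)) with ⟨-, e⟩ | ⟨-, e⟩ | ⟨-, e⟩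
  · rw [e]
    exact Or.inr ⟨congrArg (· + 1) (addBlock_cycle _ _ _), rfl, rfl⟩
  · rw [e]
    exact Or.inr ⟨congrArg (· + 1) (addBlock_cycle _ _ _), rfl, rfl⟩
  · exact Or.inl e

theorem cycle_mono (ω : ℕ → Draw) : Monotone fun n => (state ω n).cycle := by
  refine monotone_nat_of_le_succ fun n => ?_
  rcases state_succ_cases ω n with h | h
  · rw [h, addBlock_cycle]
  · rw [h.1]
    exact Nat.le_succ _

/-- The lists are emptied exactly when the cycle number increases. -/
theorem mem_blocksOf_iff {ω : ℕ → Draw} {n b : ℕ} {m : Miner} :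
    b ∈ blocksOf (state ω n) m ↔
      1 ≤ b ∧ b ≤ n ∧ cycleOf ω b = (state ω n).cycle ∧ (ω (b - 1)).1 = m := by
  induction n with
  | zero =>
    constructor
    · cases m <;> simp [state, blocksOf]
    · omega
  | succ n ih =>
    rcases state_succ_cases ω n with h | ⟨h, hf, hp⟩
    · rw [h, mem_blocksOf_addBlock, ih, addBlock_cycle]
      constructor
      · rintro (⟨h₁, h₂, h₃⟩ | ⟨rfl, h₂⟩)
        · exact ⟨h₁, h₂.trans n.le_succ, h₃⟩
        · exact ⟨by omega, le_rfl, rfl, h₂⟩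
      · rintro ⟨h₁, h₂, h₃, h₄⟩
        rcases h₂.eq_or_lt with rfl | h₂
        · exact Or.inr ⟨rfl, h₄⟩
        · exact Or.inl ⟨h₁, Nat.lt_succ_iff.1 h₂, h₃, h₄⟩
    · constructor
      · cases m <;> simp [blocksOf, hf, hp]
      · rintro ⟨h₁, h₂, h₃, -⟩
        have : cycleOf ω b ≤ (state ω n).cycle := cycle_mono ω (by omega : b - 1 ≤ n)
        omega

theorem mem_fork_iff {ω : ℕ → Draw} {n b : ℕ} : b ∈ (state ω n).fork ↔
    1 ≤ b ∧ b ≤ n ∧ cycleOf ω b = (state ω n).cycle ∧ (ω (b - 1)).1 = Miner.selfish :=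
  mem_blocksOf_iff (m := Miner.selfish)

theorem mem_pub_iff {ω : ℕ → Draw} {n b : ℕ} : b ∈ (state ω n).pub ↔
    1 ≤ b ∧ b ≤ n ∧ cycleOf ω b = (state ω n).cycle ∧ (ω (b - 1)).1 = Miner.honest :=
  mem_blocksOf_iff (m := Miner.honest)

/-- The possible lengths of the two branches during a cycle. -/
def Running (s : State) : Prop :=
  s.pub = [] ∨ (s.pub.length = 1 ∧ s.fork.length = 1) ∨ s.pub.length + 2 ≤ s.fork.length

/-- Once there is an honest block, a lead of one ends the cycle, so the lead cannot come down to 0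
or 1 and continue. The only surviving tie is one block against one. -/
theorem running_state (ω : ℕ → Draw) (n : ℕ) : Running (state ω n) := by
  induction n with
  | zero => exact Or.inl rfl
  | succ n ih =>
    rw [state, step_eq]
    rcases settle_cases (addBlock (state ω n) (n + 1) (ω n)) with ⟨-, e⟩ | ⟨-, e⟩ | ⟨h, e⟩
    · rw [e]
      exact Or.inl rfl
    · rw [e]
      exact Or.inl rfl
    · rw [e]
      rw [← List.length_pos_iff_ne_nil] at h
      unfold Running at ih ⊢
      rw [← List.length_eq_zero_iff] at ih ⊢
      rcases hx : (ω n).1 <;>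
        simp only [addBlock, hx, List.length_append, List.length_singleton] at h ⊢ <;> omega

/-- The blocks of a branch have consecutive heights, starting just above the base. -/
def Consecutive (ω : ℕ → Draw) (a : ℕ) (l : List ℕ) : Prop :=
  ∀ i b, l[i]? = some b → height ω b = height ω a + (i + 1)

theorem Consecutive.nil (ω : ℕ → Draw) (a : ℕ) : Consecutive ω a [] := by
  intro i b h
  simp at h

theorem Consecutive.concat {ω : ℕ → Draw} {a b : ℕ} {l : List ℕ} (h : Consecutive ω a l)
    (hb : height ω b = height ω a + (l.length + 1)) : Consecutive ω a (l ++ [b]) := by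
  intro i c hc
  rcases lt_or_ge i l.length with hi | hi
  · rw [List.getElem?_append_left hi] at hc
    exact h i c hc
  · rw [List.getElem?_append_right hi, List.getElem?_singleton] at hc
    split_ifs at hc with h'
    obtain rfl : i = l.length := by omega
    obtain rfl : b = c := Option.some.inj hc
    exact hb

theorem Consecutive.height_getLastD {ω : ℕ → Draw} {a : ℕ} {l : List ℕ}
    (h : Consecutive ω a l) : height ω (l.getLastD a) = height ω a + l.length := by
  rcases List.eq_nil_or_concat l with rfl | ⟨l', b, rfl⟩
  · rfl
  · rw [List.concat_eq_append] at h ⊢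
    rw [List.getLastD_concat]
    refine (h l'.length b ?_).trans ?_ <;> simp

theorem Consecutive.height_le {ω : ℕ → Draw} {a b : ℕ} {l : List ℕ}
    (h : Consecutive ω a l) (hb : b ∈ l) : height ω b ≤ height ω a + l.length := by
  obtain ⟨i, hi, e⟩ := List.mem_iff_getElem.1 hb
  have := h i b (by rw [List.getElem?_eq_getElem hi, e])
  omega

theorem height_nextParent_selfish {ω : ℕ → Draw} {s : State} (hf : Consecutive ω s.base s.fork)
    {x : Draw} (hx : x.1 = Miner.selfish) :
    height ω (nextParent s x) = height ω s.base + s.fork.length := by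
  rcases x with ⟨_ | _, _⟩
  · exact hf.height_getLastD
  · cases hx

/-- The competing public branches have equal height, so the switch does not affect the height of the
new block. -/
theorem height_nextParent_honest {ω : ℕ → Draw} {s : State} (hf : Consecutive ω s.base s.fork)
    (hp : Consecutive ω s.base s.pub) (hs : Running s) {x : Draw} (hx : x.1 = Miner.honest) :
    height ω (nextParent s x) = height ω s.base + s.pub.length := by
  rcases x with ⟨_ | _, _⟩
  · cases hx
  · unfold nextParent
    simp only
    split_ifs with h₁ h₂
    · simp [h₁]
    · have h₃ := List.length_pos_iff_ne_nil.2 h₁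
      have h₄ : s.pub.length - 1 < s.fork.length := by
        rcases hs with h | h | h
        · exact absurd h h₁
        · omega
        · omega
      rw [List.getD_eq_getElem _ _ h₄,
        hf (s.pub.length - 1) _ (List.getElem?_eq_getElem h₄)]
      omega
    · exact hp.height_getLastD

theorem consecutive_state (ω : ℕ → Draw) (n : ℕ) :
    Consecutive ω (state ω n).base (state ω n).fork ∧
      Consecutive ω (state ω n).base (state ω n).pub := by
  induction n with
  | zero => exact ⟨.nil _ _, .nil _ _⟩
  | succ n ih =>
    rcases state_succ_cases ω n with h | ⟨-, hf, hp⟩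
    · have hh : height ω (n + 1) = height ω (nextParent (state ω n) (ω n)) + 1 :=
        height_of_pos ω n.succ_pos
      rw [h, addBlock_base]
      rcases hx : (ω n).1
      · simp only [addBlock, hx]
        refine ⟨ih.1.concat ?_, ih.2⟩
        rw [hh, height_nextParent_selfish ih.1 hx, add_assoc]
      · simp only [addBlock, hx]
        refine ⟨ih.1, ih.2.concat ?_⟩
        rw [hh, height_nextParent_honest ih.1 ih.2 (running_state ω n) hx, add_assoc]
    · rw [hf, hp]
      exact ⟨.nil _ _, .nil _ _⟩

theorem parent_of_selfish {ω : ℕ → Draw} {n : ℕ} (h : (ω n).1 = Miner.selfish) :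
    parent ω (n + 1) = (state ω n).fork.getLastD (state ω n).base := by
  rw [parent]
  rcases hx : ω n with ⟨_ | _, _⟩
  · rfl
  · rw [hx] at h
    cases h

theorem fork_onChain (ω : ℕ → Draw) (n : ℕ) {b : ℕ} (hb : b ∈ (state ω n).fork) :
    OnChain ω b ((state ω n).fork.getLastD (state ω n).base) := by
  induction n with
  | zero => simp [state] at hb
  | succ n ih =>
    rcases state_succ_cases ω n with h | ⟨-, hf, hp⟩
    · rw [h, addBlock_base]
      rw [h] at hb
      rcases hx : (ω n).1
      · simp only [addBlock, hx, List.mem_append, List.mem_singleton, List.getLastD_concat]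
          at hb ⊢
        rcases hb with hb | rfl
        · rw [onChain_iff, parent_of_selfish hx]
          exact Or.inr (ih hb)
        · exact .refl _ _
      · simp only [addBlock, hx] at hb ⊢
        exact ih hb
    · simp [hf] at hb

/-- Used to exclude honest parents from the attacker's chain; below the fork, comparing block
numbers with the base is enough. -/
theorem mem_fork_of_onChain (ω : ℕ → Draw) (n : ℕ) {c : ℕ}
    (hc : OnChain ω c ((state ω n).fork.getLastD (state ω n).base)) :
    c ∈ (state ω n).fork ∨ c ≤ (state ω n).base := by
  induction n with
  | zero => exact Or.inr hc.le
  | succ n ih =>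
    rcases state_succ_cases ω n with h | ⟨-, hf, hp⟩
    · rw [h, addBlock_base] at hc ⊢
      rcases hx : (ω n).1
      · simp only [addBlock, hx, List.mem_append, List.mem_singleton, List.getLastD_concat]
          at hc ⊢
        rw [onChain_iff, parent_of_selfish hx] at hc
        rcases hc with hc | hc
        · exact Or.inl (Or.inr hc)
        · exact (ih hc).imp_left Or.inl
      · simp only [addBlock, hx] at hc ⊢
        exact ih hc
    · rw [hf] at hc
      exact Or.inr hc.le

/-! ### Start and end of a cycle -/

/-- The attack cycle number `k` starts when `n` blocks have been mined. -/
def Starts (ω : ℕ → Draw) (k n : ℕ) : Prop :=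
  (state ω n).cycle = k ∧ (state ω n).fork = [] ∧ (state ω n).pub = []

theorem Starts.cycle_lt_iff {ω : ℕ → Draw} {k e n : ℕ} (h : Starts ω k e) :
    (state ω n).cycle < k ↔ n < e := by
  constructor
  · intro hn
    by_contra! hen
    have : (state ω e).cycle ≤ (state ω n).cycle := cycle_mono ω hen
    rw [h.1] at this
    omega
  · intro hn
    have h₁ : (state ω n).cycle ≤ (state ω e).cycle := cycle_mono ω hn.le
    rw [h.1] at h₁
    -- Were step `n < e` in cycle `k`, block `n + 1` would lie in a branch that is empty at time
    -- `e`.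
    refine h₁.lt_of_ne fun h₂ => ?_
    have h₃ : n + 1 ∈ blocksOf (state ω e) (ω n).1 :=
      mem_blocksOf_iff.2 ⟨by omega, hn, h₂.trans h.1.symm, rfl⟩
    cases hx : (ω n).1 <;> simp [hx, blocksOf, h.2.1, h.2.2] at h₃

theorem Starts.unique {ω : ℕ → Draw} {k m n : ℕ} (hm : Starts ω k m) (hn : Starts ω k n) :
    m = n := by
  have h₁ := (hm.cycle_lt_iff (n := n)).not.1 (by simp [hn.1])
  have h₂ := (hn.cycle_lt_iff (n := m)).not.1 (by simp [hm.1])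
  omega

theorem Starts.exists_eq_succ {ω : ℕ → Draw} {k e : ℕ} (h : Starts ω (k + 1) e) :
    ∃ n, e = n + 1 := by
  refine Nat.exists_eq_succ_of_ne_zero fun h₀ => ?_
  rw [h₀] at h
  exact absurd h.1 (Nat.succ_ne_zero k).symm

theorem state_succ_of_selfish {ω : ℕ → Draw} {n : ℕ} (h : (ω n).1 = Miner.selfish) :
    state ω (n + 1) = settle { state ω n with fork := (state ω n).fork ++ [n + 1] } := by
  rw [state, step_eq, addBlock, h]

theorem state_succ_of_honest {ω : ℕ → Draw} {n : ℕ} (h : (ω n).1 = Miner.honest) :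
    state ω (n + 1) = settle { state ω n with pub := (state ω n).pub ++ [n + 1] } := by
  rw [state, step_eq, addBlock, h]

theorem height_succ_of_selfish {ω : ℕ → Draw} {n : ℕ} (h : (ω n).1 = Miner.selfish) :
    height ω (n + 1) = height ω (state ω n).base + (state ω n).fork.length + 1 := by
  rw [height_of_pos ω n.succ_pos, parent, height_nextParent_selfish (consecutive_state ω n).1 h]

theorem height_succ_of_honest {ω : ℕ → Draw} {n : ℕ} (h : (ω n).1 = Miner.honest) :
    height ω (n + 1) = height ω (state ω n).base + (state ω n).pub.length + 1 := by
  rw [height_of_pos ω n.succ_pos, parent, height_nextParent_honest (consecutive_state ω n).1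
    (consecutive_state ω n).2 (running_state ω n) h]

theorem height_le_of_cycleOf {ω : ℕ → Draw} {n b : ℕ} (h₀ : 1 ≤ b) (hb : b ≤ n)
    (hc : cycleOf ω b = (state ω n).cycle) :
    height ω b ≤ height ω (state ω n).base +
      max (state ω n).fork.length (state ω n).pub.length := by
  have h : b ∈ blocksOf (state ω n) (ω (b - 1)).1 := mem_blocksOf_iff.2 ⟨h₀, hb, hc, rfl⟩
  rcases hx : (ω (b - 1)).1 <;> rw [hx] at h
  · have := (consecutive_state ω n).1.height_le h
    omega
  · have := (consecutive_state ω n).2.height_le h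
    omega

/-- The two ways in which a cycle ends: either its last mined block becomes official and is higher
than all other blocks, or an honest block makes the attacker publish the rest of his fork. -/
theorem Starts.cycle_end {ω : ℕ → Draw} {k n : ℕ} (h : Starts ω (k + 1) (n + 1)) :
    (state ω n).cycle = k ∧
      (((state ω (n + 1)).base = n + 1 ∧
          ∀ b, 1 ≤ b → b ≤ n → cycleOf ω b = k → height ω b < height ω (n + 1)) ∨
        ((ω n).1 = Miner.honest ∧ (state ω n).fork.length = (state ω n).pub.length + 2 ∧
          (state ω (n + 1)).base = (state ω n).fork.getLastD (state ω n).base)) := by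
  have hr := running_state ω n
  have hpub : ∀ l : List ℕ, l = [] ↔ l.length = 0 := fun l => List.length_eq_zero_iff.symm
  unfold Running at hr
  rw [hpub] at hr
  obtain ⟨h₀, h₁, h₂⟩ := h
  rcases hx : (ω n).1
  · rw [state_succ_of_selfish hx] at h₀ h₁ h₂ ⊢
    rcases settle_cases { state ω n with fork := (state ω n).fork ++ [n + 1] } with
      ⟨e', e⟩ | ⟨e', e⟩ | ⟨-, e⟩
    · simp only [List.length_append, List.length_singleton] at e'
      omega
    · rw [e] at h₀ ⊢
      simp only [List.length_append, List.length_singleton, ne_eq, hpub] at e'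
      have hc : (state ω n).cycle = k := by simpa using h₀
      refine ⟨hc, Or.inl ⟨List.getLastD_concat .., fun b hb₁ hb hb' => ?_⟩⟩
      have := height_le_of_cycleOf hb₁ hb (hb'.trans hc.symm)
      rw [height_succ_of_selfish hx]
      omega
    · rw [e] at h₁
      simp at h₁
  · rw [state_succ_of_honest hx] at h₀ h₁ h₂ ⊢
    rcases settle_cases { state ω n with pub := (state ω n).pub ++ [n + 1] } with
      ⟨e', e⟩ | ⟨e', e⟩ | ⟨-, e⟩
    · simp only [List.length_append, List.length_singleton] at e'
      rw [e] at h₀ ⊢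
      have hc : (state ω n).cycle = k := by simpa using h₀
      refine ⟨hc, Or.inl ⟨List.getLastD_concat .., fun b hb₁ hb hb' => ?_⟩⟩
      have := height_le_of_cycleOf hb₁ hb (hb'.trans hc.symm)
      rw [height_succ_of_honest hx]
      omega
    · simp only [List.length_append, List.length_singleton] at e'
      rw [e] at h₀ ⊢
      exact ⟨by simpa using h₀, Or.inr ⟨rfl, by omega, rfl⟩⟩
    · rw [e] at h₂
      simp at h₂

theorem fork_of_honest_run {ω : ℕ → Draw} {t n : ℕ} (htn : t ≤ n)
    (hc : (state ω n).cycle = (state ω t).cycle)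
    (hh : ∀ i, t ≤ i → i < n → (ω i).1 = Miner.honest) :
    (state ω n).fork = (state ω t).fork ∧ (state ω n).base = (state ω t).base ∧
      (state ω n).pub.length = (state ω t).pub.length + (n - t) := by
  induction n, htn using Nat.le_induction with
  | base => simp
  | succ n hn ih =>
    have h₁ : (state ω t).cycle ≤ (state ω n).cycle := cycle_mono ω hn
    rcases state_succ_cases ω n with h | h
    · rw [h, addBlock_cycle] at hc
      obtain ⟨h₂, h₃, h₄⟩ := ih hc fun i hi hin => hh i hi (hin.trans n.lt_succ_self)
      rw [h]
      simp only [addBlock, hh n hn n.lt_succ_self, List.length_append, List.length_singleton]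
      exact ⟨h₂, h₃, by omega⟩
    · omega

theorem state_succ_of_honest_of_lt {ω : ℕ → Draw} {n : ℕ} (h : (ω n).1 = Miner.honest)
    (hl : (state ω n).pub.length + 2 < (state ω n).fork.length) :
    state ω (n + 1) = { state ω n with pub := (state ω n).pub ++ [n + 1] } := by
  rw [state_succ_of_honest h, settle]
  simp only [List.length_append, List.length_singleton]
  rw [if_neg (by omega), if_neg (by omega)]

theorem state_succ_of_honest_of_eq {ω : ℕ → Draw} {n : ℕ} (h : (ω n).1 = Miner.honest)
    (hl : (state ω n).fork.length = (state ω n).pub.length + 2) :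
    state ω (n + 1) =
      ⟨(state ω n).cycle + 1, (state ω n).fork.getLastD (state ω n).base, [], []⟩ := by
  rw [state_succ_of_honest h, settle]
  simp only [List.length_append, List.length_singleton]
  rw [if_neg (by omega), if_pos ⟨by simp, by omega⟩]

/-- When the attacker leads by `m + 1` blocks, then `m` honest blocks end the cycle. -/
theorem state_of_honest_run {ω : ℕ → Draw} {m : ℕ} (hm : 1 ≤ m) {t : ℕ}
    (hl : (state ω t).fork.length = (state ω t).pub.length + (m + 1))
    (hh : ∀ i < m, (ω (t + i)).1 = Miner.honest) :
    state ω (t + m) =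
      ⟨(state ω t).cycle + 1, (state ω t).fork.getLastD (state ω t).base, [], []⟩ := by
  induction m, hm using Nat.le_induction generalizing t with
  | base => exact state_succ_of_honest_of_eq (hh 0 one_pos) hl
  | succ m hm ih =>
    have h := state_succ_of_honest_of_lt (n := t) (hh 0 m.succ_pos) (by omega)
    rw [show t + (m + 1) = t + 1 + m by omega, ih (t := t + 1), h]
    · rw [h]
      simp only [List.length_append, List.length_singleton]
      omega
    · intro i hi
      rw [show t + 1 + i = t + (i + 1) by omega]
      exact hh _ (by omega)

/-! ### Which uncles wait for a later cycle -/

/-- The block mined at step `t` belongs to the `m` honest blocks which end the cycle number `k`, it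
is the `m`-th one counted from the end, and its parent is in the attacker's branch or is the base of
the cycle. -/
def TailBlock (k m : ℕ) (ω : ℕ → Draw) (t : ℕ) : Prop :=
  (state ω t).cycle = k ∧ (state ω t).fork.length = (state ω t).pub.length + (m + 1) ∧
    (∀ i < m, (ω (t + i)).1 = Miner.honest) ∧ ((state ω t).pub = [] ∨ (ω t).2 = true)

theorem TailBlock.starts {k m : ℕ} {ω : ℕ → Draw} {t : ℕ} (h : TailBlock k m ω t) (hm : 1 ≤ m) :
    Starts ω (k + 1) (t + m) := by
  obtain ⟨h₁, h₂, h₃, -⟩ := h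
  rw [Starts, state_of_honest_run hm h₂ h₃, h₁]
  exact ⟨rfl, rfl, rfl⟩

theorem Official.of_onChain {ω : ℕ → Draw} {a b : ℕ} (hb : Official ω b) (h : OnChain ω a b) :
    Official ω a := by
  obtain ⟨n, hn⟩ := hb
  exact ⟨n, h.trans hn⟩

theorem Starts.le_base_of_official {ω : ℕ → Draw} {k e b : ℕ} (h : Starts ω k e)
    (hb : Official ω b) (hbe : b ≤ e) : OnChain ω b (state ω e).base :=
  hb.onChain_base h.2.1 h.2.2 hbe

theorem base_le (ω : ℕ → Draw) (n : ℕ) : (state ω n).base ≤ n := live_le (base_mem_live _)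

/-- Each completed cycle adds an official block; this provides the nephew in `TailBlock.mem_uncles`.
-/
theorem Starts.base_lt_base {ω : ℕ → Draw} {k e e' : ℕ} (h : Starts ω k e)
    (h' : Starts ω (k + 1) e') : (state ω e).base < (state ω e').base := by
  obtain ⟨n, rfl⟩ := h'.exists_eq_succ
  obtain ⟨hc, ⟨hb, -⟩ | ⟨-, hl, hb⟩⟩ := h'.cycle_end
  · have := (h.cycle_lt_iff (n := n)).not.1 (by omega)
    have := base_le ω e
    omega
  · have hm : (state ω (n + 1)).base ∈ (state ω n).fork := by
      rw [hb]
      exact getLastD_mem (List.length_pos_iff_ne_nil.1 (by omega)) _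
    obtain ⟨h₁, h₂, h₃, -⟩ := mem_fork_iff.1 hm
    have := (h.cycle_lt_iff (n := (state ω (n + 1)).base - 1)).not.1
      (by rw [← cycleOf, h₃, hc]; exact lt_irrefl _)
    have := base_le ω e
    omega

/-- The new base was mined before `t + 1`, so the block is an orphan that no official block up to
the base can refer to. The nephew is the first official block above the base, at distance `m + 1`.
-/
theorem TailBlock.mem_uncles {n₁ k m : ℕ} {ω : ℕ → Draw} {t e' : ℕ} (h : TailBlock k m ω t)
    (hm : 1 ≤ m) (hmn : m + 1 ≤ n₁) (h' : Starts ω (k + 2) e') :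
    cycleOf ω (t + 1) = k ∧ Uncle ω (t + 1) ∧
      ∃ N : ℕ, Official ω N ∧ k < cycleOf ω N ∧ Refers n₁ ω N (t + 1) := by
  have hs := h.starts hm
  obtain ⟨hc, hl, hh, hsw⟩ := h
  have hx : (ω t).1 = Miner.honest := hh 0 hm
  have hb : (state ω (t + m)).base = (state ω t).fork.getLastD (state ω t).base := by
    rw [state_of_honest_run hm hl hh]
  have hbt : (state ω (t + m)).base ≤ t := by
    rw [hb]
    refine live_le (ω := ω) (n := t) ?_
    rcases getLastD_eq_or_mem (state ω t).fork (state ω t).base with h | h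
    · exact Or.inl h
    · exact Or.inr (Or.inl h)
  have hU : ¬ Official ω (t + 1) := by
    intro h
    have := (hs.le_base_of_official h (by omega)).le
    omega
  have hp : OnChain ω (parent ω (t + 1)) (state ω (t + m)).base := by
    rw [parent]
    rcases hω : ω t with ⟨_ | _, c⟩
    · rw [hω] at hx
      cases hx
    · unfold nextParent
      simp only
      split_ifs with h₁ h₂
      · exact base_onChain_base (Nat.le_add_right _ _)
      · have h₃ := List.length_pos_iff_ne_nil.2 h₁
        rw [List.getD_eq_getElem _ _ (show _ < _ by omega), hb]
        exact fork_onChain ω t (List.getElem_mem _)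
      · rw [hω] at hsw
        rcases hsw with h | h
        · exact absurd h h₁
        · exact absurd h h₂
  obtain ⟨N, hN₁, hN₂, hN₃⟩ := (base_onChain_base
    (((hs.cycle_lt_iff (n := e')).not.1 (by rw [h'.1]; omega) |> not_lt.1))).exists_child
      (hs.base_lt_base h')
  have hN : Official ω N := ⟨e', hN₁⟩
  have hNe : t + m < N := by
    by_contra! h
    have := (hs.le_base_of_official hN h).le
    omega
  have hBN : OnChain ω (state ω (t + m)).base N := hN₂ ▸ onChain_parent ω N
  refine ⟨hc, ⟨hU, ⟨_, hp⟩⟩, N, hN, ?_, ?_⟩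
  · have : (state ω (t + m)).cycle ≤ (state ω (N - 1)).cycle := cycle_mono ω (by omega)
    rw [hs.1] at this
    exact this
  · have hhN : height ω N = height ω (state ω t).base + (state ω t).fork.length + 1 := by
      rw [height_of_pos ω (by omega), hN₂, hb, (consecutive_state ω t).1.height_getLastD]
    have hhU := height_succ_of_honest hx
    rw [Refers]
    refine ⟨⟨by omega, fun h => hU (hN.of_onChain h), hp.trans hBN, by omega, by omega⟩,
      fun M hM hMN hR => ?_⟩
    -- Earlier blocks on the chain of `N` have numbers at most that of the base, hence at most `t`,
    -- too small to refer to `t + 1`.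
    rw [Refers] at hR
    have h₁ := hR.1.1
    rcases onChain_iff.1 hMN with h | h
    · omega
    · have := h.le
      omega

/-- A reference still open after the cycle forces the uncle to be younger than the new base. This
leaves only the final honest run, where the parent must be on the attacker's branch or be the old
base. -/
theorem exists_tailBlock {n₁ k : ℕ} {ω : ℕ → Draw} {t e N : ℕ} (he : Starts ω (k + 1) e)
    (hc : cycleOf ω (t + 1) = k) (hU : Uncle ω (t + 1)) (hN : Official ω N)
    (hNk : k < cycleOf ω N) (hR : Refers n₁ ω N (t + 1)) :
    ∃ m, 1 ≤ m ∧ m + 1 ≤ n₁ ∧ TailBlock k m ω t := by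
  have hct : (state ω t).cycle = k := hc
  have hte : t < e := he.cycle_lt_iff.1 (by omega)
  have hNe : e < N := by
    have := (he.cycle_lt_iff (n := N - 1)).not.1 (by rw [← cycleOf]; omega)
    have := he.exists_eq_succ
    omega
  have hbe := base_le ω e
  have hBN : OnChain ω (state ω e).base N := by
    obtain ⟨n', hn'⟩ := hN
    have h₁ := hn'.le
    have h₂ := base_le ω n'
    exact (base_onChain_base (by omega)).linear hn' (by omega)
  have hne : t + 1 ≠ (state ω e).base := by
    intro h
    exact hU.1 ⟨e, h ▸ .refl _ _⟩
  have hpB : OnChain ω (parent ω (t + 1)) (state ω e).base :=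
    he.le_base_of_official hU.2 ((parent_le ω _).trans hte)
  obtain ⟨n, rfl⟩ := he.exists_eq_succ
  obtain ⟨hcn, hend⟩ := he.cycle_end
  -- Otherwise the new base is younger and higher than the uncle and precludes a reference by `N`.
  have hlt : (state ω (n + 1)).base < t + 1 := by
    refine lt_of_le_of_ne (not_lt.1 fun h => ?_) hne.symm
    refine hR.false_of_between hBN (by omega) h ?_ hpB
    rcases hend with ⟨hb, h₁⟩ | ⟨-, hl, hb⟩
    · rw [hb]
      exact h₁ _ (by omega) (by omega) hc
    · have hB := (consecutive_state ω n).1.height_getLastD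
      rw [hb] at h ⊢
      rcases hx : (ω t).1
      · have hm : t + 1 ∈ (state ω n).fork :=
          mem_fork_iff.2 ⟨by omega, by omega, hc.trans hcn.symm, hx⟩
        exact (fork_onChain ω n hm).height_lt h
      · have hm : t + 1 ∈ (state ω n).pub :=
          mem_pub_iff.2 ⟨by omega, by omega, hc.trans hcn.symm, hx⟩
        have := (consecutive_state ω n).2.height_le hm
        omega
  rcases hend with ⟨hb, -⟩ | ⟨hx, hl, hb⟩
  · omega
  -- The new base is the attacker's last block of the cycle and is older than `t + 1`.
  have hrun : ∀ i, t ≤ i → i < n + 1 → (ω i).1 = Miner.honest := by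
    intro i hti hin
    rcases (Nat.lt_succ_iff.1 hin).eq_or_lt with rfl | hin
    · exact hx
    · rcases hi : (ω i).1
      · have h₁ : (state ω t).cycle ≤ (state ω i).cycle := cycle_mono ω hti
        have h₂ : (state ω i).cycle ≤ (state ω n).cycle := cycle_mono ω hin.le
        have hm : i + 1 ∈ (state ω n).fork :=
          mem_fork_iff.2 ⟨by omega, hin, (by omega : (state ω i).cycle = _), hi⟩
        have := (fork_onChain ω n hm).le
        omega
      · rfl
  obtain ⟨hf, hbt, hpl⟩ := fork_of_honest_run (Nat.lt_succ_iff.1 hte) (hcn.trans hct.symm)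
    fun i hi hin => hrun i hi (hin.trans n.lt_succ_self)
  have hxt := hrun t le_rfl hte
  have hB : height ω (state ω (n + 1)).base =
      height ω (state ω n).base + (state ω n).fork.length := by
    rw [hb, (consecutive_state ω n).1.height_getLastD]
  -- `m` counts the honest steps from `t` to `n`, both included.
  refine ⟨n - t + 1, by omega, ?_, hct, by rw [← hf]; omega, fun i hi => hrun _ (by omega)
    (by omega), ?_⟩
  · rw [Refers] at hR
    have h₁ := hR.1.2.2.2.2
    have h₂ := hBN.height_lt (by omega)
    have h₃ := height_succ_of_honest hxt
    rw [← hbt] at h₃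
    omega
  -- Otherwise the parent is the last honest block. To be on the attacker's chain it would have to
  -- be one of his blocks or the old base, against its miner or its height.
  · by_contra! hcon
    have hpar : parent ω (t + 1) = (state ω t).pub.getLastD (state ω t).base := by
      rw [parent]
      rcases hω : ω t with ⟨_ | _, c⟩
      · rw [hω] at hxt
        cases hxt
      · rw [hω] at hcon
        unfold nextParent
        simp only
        rw [if_neg hcon.1, if_neg hcon.2]
    have hmem := getLastD_mem hcon.1 (state ω t).base
    have hht := (consecutive_state ω t).2.height_getLastD
    have hpos := List.length_pos_iff_ne_nil.2 hcon.1
    rw [← hpar] at hmem hht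
    rw [hb] at hpB
    rcases mem_fork_of_onChain ω n hpB with h | h
    · have h₁ := (mem_fork_iff.1 h).2.2.2
      have h₂ := (mem_pub_iff.1 hmem).2.2.2
      rw [h₁] at h₂
      cases h₂
    · have h₁ := (base_onChain_live (Or.inr (Or.inr hmem))).le
      rw [hbt] at h
      rw [h.antisymm h₁] at hht
      omega

/-- When the cycles number `k` and `k + 1` end, the uncles counted by `V` are given by the final
honest blocks of the cycle. -/
theorem V_eq_ncard {n₁ k : ℕ} {ω : ℕ → Draw} {e e' : ℕ} (he : Starts ω (k + 1) e)
    (he' : Starts ω (k + 2) e') :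
    V n₁ k ω = Set.ncard {t : ℕ | ∃ m, 1 ≤ m ∧ m + 1 ≤ n₁ ∧ TailBlock k m ω t} := by
  rw [V, ← Set.ncard_image_of_injective {t | ∃ m, 1 ≤ m ∧ m + 1 ≤ n₁ ∧ TailBlock k m ω t}
    Nat.succ_injective]
  congr 1
  ext U
  constructor
  · rintro ⟨h₀, hc, hU, N, hN, hNk, hR⟩
    obtain ⟨t, rfl⟩ := Nat.exists_eq_succ_of_ne_zero h₀
    exact ⟨t, exists_tailBlock he hc hU hN hNk hR, rfl⟩
  · rintro ⟨t, ⟨m, hm, hmn, h⟩, rfl⟩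
    exact ⟨t.succ_ne_zero, h.mem_uncles hm hmn he'⟩

/-! ### Events determined by finitely many draws, and their probabilities -/

instance : Finite Miner :=
  Finite.of_injective (fun m : Miner => decide (m = Miner.selfish)) fun a b => by
    cases a <;> cases b <;> simp

instance : DiscreteMeasurableSpace Miner := ⟨fun _ => trivial⟩

/-- The event `A` only depends on the first `n` draws. -/
def Past (n : ℕ) (A : Set (ℕ → Draw)) : Prop :=
  ∀ ω ω' : ℕ → Draw, (∀ i < n, ω i = ω' i) → ω ∈ A → ω' ∈ A

theorem Past.eq_preimage {n : ℕ} {A : Set (ℕ → Draw)} (h : Past n A) :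
    A = (Finset.range n).restrict ⁻¹' ((Finset.range n).restrict '' A) := by
  refine Set.Subset.antisymm (Set.subset_preimage_image _ _) ?_
  rintro ω ⟨ω', h', e⟩
  exact h ω' ω (fun i hi => congrFun e ⟨i, Finset.mem_range.2 hi⟩) h'

theorem Past.measurableSet {n : ℕ} {A : Set (ℕ → Draw)} (h : Past n A) : MeasurableSet A := by
  rw [h.eq_preimage]
  exact Finset.measurable_restrict _ (Set.toFinite _).measurableSet

theorem Past.mono {m n : ℕ} {A : Set (ℕ → Draw)} (h : Past m A) (hmn : m ≤ n) : Past n A :=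
  fun ω ω' e => h ω ω' fun i hi => e i (hi.trans_le hmn)

theorem Past.union {n : ℕ} {A B : Set (ℕ → Draw)} (hA : Past n A) (hB : Past n B) :
    Past n (A ∪ B) :=
  fun ω ω' e => Or.imp (hA ω ω' e) (hB ω ω' e)

theorem Past.inter_draw {n : ℕ} {A : Set (ℕ → Draw)} (h : Past n A) (B : Set Draw) :
    Past (n + 1) (A ∩ {ω | ω n ∈ B}) := by
  rintro ω ω' e ⟨h₁, h₂⟩
  refine ⟨h.mono n.le_succ ω ω' e h₁, ?_⟩
  simpa [← e n n.lt_succ_self] using h₂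

section Law

variable {q γ : ℝ} [IsProbabilityMeasure (drawLaw q γ)]

instance isProbabilityMeasure_historyLaw : IsProbabilityMeasure (historyLaw q γ) := by
  unfold historyLaw
  infer_instance

/-- The first `n` draws are independent of draw `n`, and every set of finitely many draws is
measurable because `Draw` is finite. -/
theorem Past.measure_inter_draw {n : ℕ} {A : Set (ℕ → Draw)} (h : Past n A) (B : Set Draw) :
    historyLaw q γ (A ∩ {ω | ω n ∈ B}) = historyLaw q γ A * drawLaw q γ B := by
  have hi : iIndepFun (fun (i : ℕ) (ω : ℕ → Draw) => ω i) (historyLaw q γ) :=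
    iIndepFun_infinitePi (P := fun _ : ℕ => drawLaw q γ) (X := fun _ x => x)
      fun _ => measurable_id
  have h₁ := hi.indepFun_finset (Finset.range n) {n} (by simp) fun i => measurable_pi_apply i
  have h₂ := h₁.measure_inter_preimage_eq_mul ((Finset.range n).restrict '' A)
    {x | x ⟨n, Finset.mem_singleton_self n⟩ ∈ B} (Set.toFinite _).measurableSet
    (Set.toFinite _).measurableSet
  have h₃ : historyLaw q γ {ω | ω n ∈ B} = drawLaw q γ B := by
    rw [← Measure.infinitePi_map_eval (fun _ : ℕ => drawLaw q γ) n,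
      Measure.map_apply (measurable_pi_apply n) (Set.toFinite _).measurableSet]
    rfl
  rw [← h₃]
  conv_lhs => rw [h.eq_preimage]
  conv_rhs => rw [h.eq_preimage]
  exact h₂

theorem Past.measure_inter_run {n : ℕ} {A : Set (ℕ → Draw)} (h : Past n A) (B : Set Draw)
    (j : ℕ) : historyLaw q γ (A ∩ {ω | ∀ i < j, ω (n + i) ∈ B}) =
      historyLaw q γ A * drawLaw q γ B ^ j := by
  have key : Past (n + j) (A ∩ {ω | ∀ i < j, ω (n + i) ∈ B}) ∧
      historyLaw q γ (A ∩ {ω | ∀ i < j, ω (n + i) ∈ B}) =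
        historyLaw q γ A * drawLaw q γ B ^ j := by
    induction j with
    | zero => simpa using h
    | succ j ih =>
      have e : A ∩ {ω | ∀ i < j + 1, ω (n + i) ∈ B} =
          (A ∩ {ω | ∀ i < j, ω (n + i) ∈ B}) ∩ {ω | ω (n + j) ∈ B} := by
        ext ω
        simp only [Set.mem_inter_iff, Set.mem_ofPred_eq, Nat.forall_lt_succ_right, and_assoc]
      rw [e, ih.1.measure_inter_draw, ih.2, pow_succ, mul_assoc]
      exact ⟨ih.1.inter_draw B, rfl⟩
  exact key.2

end Law

/-- The draws of a given miner. -/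
def minedBy (m : Miner) : Set Draw := {x | x.1 = m}

theorem twoPoint_apply {α : Type*} [MeasurableSpace α] [MeasurableSingletonClass α] (r : ℝ)
    (a b : α) (s : Set α) [Decidable (a ∈ s)] [Decidable (b ∈ s)] :
    twoPoint r a b s =
      (if a ∈ s then ENNReal.ofReal r else 0) + if b ∈ s then ENNReal.ofReal (1 - r) else 0 := by
  simp [twoPoint, Measure.dirac_apply, Set.indicator_apply]

theorem twoPoint_univ {α : Type*} [MeasurableSpace α] [MeasurableSingletonClass α] {r : ℝ}
    (h₀ : 0 ≤ r) (h₁ : r ≤ 1) (a b : α) : twoPoint r a b Set.univ = 1 := by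
  classical
  rw [twoPoint_apply, if_pos (Set.mem_univ a), if_pos (Set.mem_univ b), ← ENNReal.ofReal_add h₀ (by linarith)]
  simp

theorem isProbabilityMeasure_drawLaw {q γ : ℝ} (hq₀ : 0 ≤ q) (hq₁ : q ≤ 1) (hγ₀ : 0 ≤ γ)
    (hγ₁ : γ ≤ 1) : IsProbabilityMeasure (drawLaw q γ) := by
  have : IsProbabilityMeasure (twoPoint q Miner.selfish Miner.honest) :=
    ⟨twoPoint_univ hq₀ hq₁ _ _⟩
  have : IsProbabilityMeasure (twoPoint γ true false) := ⟨twoPoint_univ hγ₀ hγ₁ _ _⟩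
  unfold drawLaw
  infer_instance

instance (r : ℝ) {α : Type*} [MeasurableSpace α] (a b : α) : IsFiniteMeasure (twoPoint r a b) := by
  have : IsFiniteMeasure (ENNReal.ofReal r • Measure.dirac a) :=
    Measure.smul_finite _ ENNReal.ofReal_ne_top
  have : IsFiniteMeasure (ENNReal.ofReal (1 - r) • Measure.dirac b) :=
    Measure.smul_finite _ ENNReal.ofReal_ne_top
  unfold twoPoint
  infer_instance

theorem drawLaw_minedBy {q γ : ℝ} (hγ₀ : 0 ≤ γ) (hγ₁ : γ ≤ 1) (m : Miner) :
    drawLaw q γ (minedBy m) = twoPoint q Miner.selfish Miner.honest {m} := by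
  have : minedBy m = {m} ×ˢ Set.univ := by
    ext x
    simp [minedBy]
  rw [this, drawLaw, Measure.prod_prod, twoPoint_univ hγ₀ hγ₁, mul_one]

theorem drawLaw_selfish {q γ : ℝ} (hγ₀ : 0 ≤ γ) (hγ₁ : γ ≤ 1) :
    drawLaw q γ (minedBy Miner.selfish) = ENNReal.ofReal q := by
  classical
  rw [drawLaw_minedBy hγ₀ hγ₁, twoPoint_apply]
  simp

theorem drawLaw_honest {q γ : ℝ} (hγ₀ : 0 ≤ γ) (hγ₁ : γ ≤ 1) :
    drawLaw q γ (minedBy Miner.honest) = ENNReal.ofReal (1 - q) := by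
  classical
  rw [drawLaw_minedBy hγ₀ hγ₁, twoPoint_apply]
  simp

theorem drawLaw_honest_onFork (q γ : ℝ) :
    drawLaw q γ {x | x.1 = Miner.honest ∧ x.2 = true} =
      ENNReal.ofReal (1 - q) * ENNReal.ofReal γ := by
  classical
  have : {x : Draw | x.1 = Miner.honest ∧ x.2 = true} = {Miner.honest} ×ˢ {true} := by
    ext x
    simp [Prod.ext_iff]
  rw [this, drawLaw, Measure.prod_prod, twoPoint_apply, twoPoint_apply]
  simp

/-! ## Numbers of visits -/

theorem state_congr {ω ω' : ℕ → Draw} {n : ℕ} (h : ∀ i < n, ω i = ω' i) :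
    state ω n = state ω' n := by
  induction n with
  | zero => rfl
  | succ n ih => rw [state, state, ih fun i hi => h i (hi.trans n.lt_succ_self),
      h n n.lt_succ_self]

/-- The event that the number of the cycle and the lengths of the two branches satisfy `R` after
`n` blocks. -/
def shapeEvent (R : ℕ → ℕ → ℕ → Prop) (n : ℕ) : Set (ℕ → Draw) :=
  {ω | R (state ω n).cycle (state ω n).fork.length (state ω n).pub.length}

theorem past_shapeEvent (R : ℕ → ℕ → ℕ → Prop) (n : ℕ) : Past n (shapeEvent R n) := by
  intro ω ω' h hω
  rw [shapeEvent, Set.mem_ofPred_eq, ← state_congr h]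
  exact hω

/-- The expected number of times at which `R` is satisfied. -/
noncomputable def visits (q γ : ℝ) (R : ℕ → ℕ → ℕ → Prop) : ℝ≥0∞ :=
  ∑' n, historyLaw q γ (shapeEvent R n)

theorem visits_or (q γ : ℝ) {R R' : ℕ → ℕ → ℕ → Prop} (h : ∀ c f a, ¬ (R c f a ∧ R' c f a)) :
    visits q γ (fun c f a => R c f a ∨ R' c f a) = visits q γ R + visits q γ R' := by
  rw [visits, visits, visits, ← ENNReal.tsum_add]
  congr 1
  ext n
  rw [← measure_union _ (past_shapeEvent R' n).measurableSet]
  · rfl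
  · exact Set.disjoint_left.2 fun ω h₁ h₂ => h _ _ _ ⟨h₁, h₂⟩

theorem visits_false (q γ : ℝ) : visits q γ (fun _ _ _ => False) = 0 := by
  simp [visits, shapeEvent]

theorem running_lengths (ω : ℕ → Draw) (n : ℕ) : (state ω n).pub.length = 0 ∨
    ((state ω n).pub.length = 1 ∧ (state ω n).fork.length = 1) ∨
    (state ω n).pub.length + 2 ≤ (state ω n).fork.length := by
  have := running_state ω n
  unfold Running at this
  rwa [← List.length_eq_zero_iff] at this

theorem shape_succ_of_selfish (R : ℕ → ℕ → ℕ → Prop) {ω : ℕ → Draw} {n : ℕ}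
    (h : (ω n).1 = Miner.selfish) : ω ∈ shapeEvent R (n + 1) ↔
      if 1 ≤ (state ω n).pub.length ∧ (state ω n).fork.length = (state ω n).pub.length then
        R ((state ω n).cycle + 1) 0 0
      else R (state ω n).cycle ((state ω n).fork.length + 1) (state ω n).pub.length := by
  have hr := running_lengths ω n
  rw [shapeEvent, Set.mem_ofPred_eq, state_succ_of_selfish h, settle]
  simp only [List.length_append, List.length_singleton, ne_eq, ← List.length_eq_zero_iff]
  -- By `running_lengths`, an attacker's block never leaves his fork shorter than the honest chain.
  rw [if_neg (by omega)]
  split_ifs with h₁ h₂ h₂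
  · rfl
  · omega
  · omega
  · simp

theorem shape_succ_of_honest (R : ℕ → ℕ → ℕ → Prop) {ω : ℕ → Draw} {n : ℕ}
    (h : (ω n).1 = Miner.honest) : ω ∈ shapeEvent R (n + 1) ↔
      if (state ω n).fork.length ≤ (state ω n).pub.length ∨
          (state ω n).fork.length = (state ω n).pub.length + 2 then
        R ((state ω n).cycle + 1) 0 0
      else R (state ω n).cycle (state ω n).fork.length ((state ω n).pub.length + 1) := by
  rw [shapeEvent, Set.mem_ofPred_eq, state_succ_of_honest h, settle]
  simp only [List.length_append, List.length_singleton, ne_eq, List.append_eq_nil_iff,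
    List.cons_ne_nil, and_false, not_false_eq_true, true_and]
  split_ifs <;> first | rfl | omega | simp

/-- The first-step equations for the numbers of visits. -/
theorem visits_eq {q γ : ℝ} [IsProbabilityMeasure (drawLaw q γ)]
    {R R₁ R₂ : ℕ → ℕ → ℕ → Prop} (h₀ : ¬ R 0 0 0)
    (h₁ : ∀ c f a, (a = 0 ∨ (a = 1 ∧ f = 1) ∨ a + 2 ≤ f) →
      (R₁ c f a ↔ if 1 ≤ a ∧ f = a then R (c + 1) 0 0 else R c (f + 1) a))
    (h₂ : ∀ c f a, (a = 0 ∨ (a = 1 ∧ f = 1) ∨ a + 2 ≤ f) →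
      (R₂ c f a ↔ if f ≤ a ∨ f = a + 2 then R (c + 1) 0 0 else R c f (a + 1))) :
    visits q γ R = visits q γ R₁ * drawLaw q γ (minedBy Miner.selfish) +
      visits q γ R₂ * drawLaw q γ (minedBy Miner.honest) := by
  have hz : historyLaw q γ (shapeEvent R 0) = 0 := by
    simp [shapeEvent, state, h₀]
  rw [visits, tsum_eq_zero_add' ENNReal.summable, hz, zero_add, visits, visits,
    ← ENNReal.tsum_mul_right, ← ENNReal.tsum_mul_right, ← ENNReal.tsum_add]
  congr 1
  ext n
  rw [← (past_shapeEvent R₁ n).measure_inter_draw, ← (past_shapeEvent R₂ n).measure_inter_draw,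
    ← measure_union _ ((past_shapeEvent R₂ n).inter_draw _).measurableSet]
  · congr 1
    ext ω
    have hr := running_lengths ω n
    have e₁ := h₁ (state ω n).cycle _ _ hr
    have e₂ := h₂ (state ω n).cycle _ _ hr
    simp only [Set.mem_union, Set.mem_inter_iff, minedBy, Set.mem_ofPred_eq]
    rcases hx : (ω n).1
    · rw [shape_succ_of_selfish R hx, ← e₁]
      simp [shapeEvent]
    · rw [shape_succ_of_honest R hx, ← e₂]
      simp [shapeEvent]
  · refine Set.disjoint_left.2 fun ω h₃ h₄ => ?_
    have h₅ : (ω n).1 = Miner.selfish := h₃.2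
    have h₆ : (ω n).1 = Miner.honest := h₄.2
    rw [h₅] at h₆
    cases h₆

/-- In cycle number `k` there is no honest block yet, and the attacker has mined `x` blocks. -/
def Secret (k x c f a : ℕ) : Prop := c = k ∧ a = 0 ∧ f = x

/-- In cycle number `k` the attacker leads by `x` blocks. -/
def Lead (k x c f a : ℕ) : Prop := c = k ∧ f = a + x

/-- In cycle number `k` both branches have length one. -/
def Tie (k c f a : ℕ) : Prop := c = k ∧ f = 1 ∧ a = 1

theorem shapeEvent_start (k n : ℕ) : shapeEvent (Secret k 0) n = {ω | Starts ω k n} := by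
  ext ω
  simp only [shapeEvent, Secret, Starts, Set.mem_ofPred_eq, List.length_eq_zero_iff]
  tauto

/-- A given cycle starts at most once, so the expected number of starts is a probability, hence at
most 1. -/
theorem visits_start_eq_measure (q γ : ℝ) (k : ℕ) :
    visits q γ (Secret k 0) = historyLaw q γ {ω | ∃ n, Starts ω k n} := by
  have : {ω | ∃ n, Starts ω k n} = ⋃ n, shapeEvent (Secret k 0) n := by
    ext ω
    simp [shapeEvent_start]
  rw [this, measure_iUnion, visits]
  · intro m n hmn
    refine Set.disjoint_left.2 fun ω h₁ h₂ => hmn ?_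
    rw [shapeEvent_start] at h₁ h₂
    exact Starts.unique h₁ h₂
  · exact fun n => (past_shapeEvent _ n).measurableSet

section Law

variable {q γ : ℝ} [IsProbabilityMeasure (drawLaw q γ)]

theorem visits_secret_succ (k x : ℕ) : visits q γ (Secret k (x + 1)) =
    visits q γ (Secret k x) * drawLaw q γ (minedBy Miner.selfish) := by
  rw [visits_eq (R := Secret k (x + 1)) (R₁ := Secret k x) (R₂ := fun _ _ _ => False),
    visits_false, zero_mul, add_zero]
  · simp [Secret]
  · intro c f a h
    split_ifs <;> simp only [Secret] <;> omega
  · intro c f a h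
    split_ifs <;> simp [Secret]

/-- With an honest block present, a lead of one ends the cycle; so this lead occurs only after an
opening S. -/
theorem visits_lead_one (k : ℕ) : visits q γ (Lead k 1) =
    visits q γ (Secret k 0) * drawLaw q γ (minedBy Miner.selfish) := by
  rw [visits_eq (R := Lead k 1) (R₁ := Secret k 0) (R₂ := fun _ _ _ => False),
    visits_false, zero_mul, add_zero]
  · simp [Lead]
  · intro c f a h
    split_ifs <;> simp only [Secret, Lead] <;> omega
  · intro c f a h
    split_ifs <;> simp only [Lead, false_iff] <;> omega

theorem visits_lead_succ (k x : ℕ) : visits q γ (Lead k (x + 2)) =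
    visits q γ (Lead k (x + 1)) * drawLaw q γ (minedBy Miner.selfish) +
      visits q γ (Lead k (x + 3)) * drawLaw q γ (minedBy Miner.honest) := by
  apply visits_eq
  · simp [Lead]
  · intro c f a h
    split_ifs <;> simp only [Lead] <;> omega
  · intro c f a h
    split_ifs <;> simp only [Lead] <;> omega

theorem visits_tie (k : ℕ) : visits q γ (Tie k) =
    visits q γ (Lead k 1) * drawLaw q γ (minedBy Miner.honest) := by
  rw [visits_eq (R := Tie k) (R₁ := fun _ _ _ => False) (R₂ := Lead k 1),
    visits_false, zero_mul, zero_add]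
  · simp [Tie]
  · intro c f a h
    split_ifs <;> simp only [Tie, false_iff] <;> omega
  · intro c f a h
    split_ifs <;> simp only [Tie, Lead] <;> omega

/-- A cycle ends by an immediate H, by any block after a tie, or by H at lead 2. -/
theorem visits_start_succ (k : ℕ) : visits q γ (Secret (k + 1) 0) =
    visits q γ (Tie k) * drawLaw q γ (minedBy Miner.selfish) +
      (visits q γ (Secret k 0) + (visits q γ (Tie k) + visits q γ (Lead k 2))) *
        drawLaw q γ (minedBy Miner.honest) := by
  rw [← visits_or (R := Tie k) (R' := Lead k 2), ← visits_or (R := Secret k 0)]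
  · apply visits_eq
    · simp [Secret]
    · intro c f a h
      split_ifs <;> simp only [Secret, Tie, and_true] <;> omega
    · intro c f a h
      split_ifs <;> simp only [Secret, Tie, Lead, and_true] <;> omega
  · intro c f a
    simp only [Secret, Tie, Lead]
    omega
  · intro c f a
    simp only [Tie, Lead]
    omega

theorem visits_start_zero : visits q γ (Secret 0 0) = 1 := by
  rw [visits_start_eq_measure]
  have : {ω : ℕ → Draw | ∃ n, Starts ω 0 n} = Set.univ :=
    Set.eq_univ_of_forall fun ω => ⟨0, rfl, rfl, rfl⟩
  rw [this, measure_univ]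

end Law

/-! ### Solving the first-step equations -/

/-- A nonnegative solution of the equations for the numbers of visits has no loss at infinity. -/
theorem green_function {p q : ℝ} (hpq : p + q = 1) (hp : 0 < p) (hqp : q ≤ p) {g : ℕ → ℝ}
    (hg : ∀ x, 0 ≤ g x) (h₀ : g 0 = q) (h : ∀ x, g (x + 1) = q * g x + p * g (x + 2))
    (h₁ : p * g 1 ≤ q ^ 2) (x : ℕ) : p ^ x * g x = q ^ (x + 1) := by
  -- The net flow between consecutive levels does not depend on `x`.
  have hflow : ∀ x, p * g (x + 1) = q * g x - (q ^ 2 - p * g 1) := by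
    intro x
    induction x with
    | zero => rw [h₀, zero_add]; ring
    | succ x ih =>
      have e := h x
      have : p * g (x + 1) + q * g (x + 1) = g (x + 1) := by rw [← add_mul, hpq, one_mul]
      linarith
  have hdec : ∀ x : ℕ, p * g x ≤ p * g 0 - x * (q ^ 2 - p * g 1) := by
    intro x
    induction x with
    | zero => simp
    | succ x ih =>
      have := mul_le_mul_of_nonneg_right hqp (hg x)
      have := hflow x
      push_cast
      linarith
  -- A positive loss would make `p * g x` fall at least linearly, using `q ≤ p`, and become
  -- negative.
  have hδ : q ^ 2 - p * g 1 = 0 := by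
    refine le_antisymm (not_lt.1 fun hlt => ?_) (by linarith)
    obtain ⟨n, hn⟩ := exists_nat_gt (p * g 0 / (q ^ 2 - p * g 1))
    rw [div_lt_iff₀ hlt] at hn
    have := hdec n
    have := mul_nonneg hp.le (hg n)
    linarith
  induction x with
  | zero => simp [h₀]
  | succ x ih =>
    have := hflow x
    rw [hδ, sub_zero] at this
    rw [pow_succ, mul_assoc, this, mul_left_comm, ih]
    ring

section Values

variable {p q γ : ℝ}

/-- Inductive step over cycles: the same argument shows that cycle `k` ends almost surely and
computes its visits. -/
theorem visits_values (hpq : p + q = 1) (hq : 0 ≤ q) (hqp : q ≤ p) (hγ₀ : 0 ≤ γ) (hγ₁ : γ ≤ 1)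
    {k : ℕ} (hk : visits q γ (Secret k 0) = 1) :
    visits q γ (Secret (k + 1) 0) = 1 ∧ (∀ x, visits q γ (Lead k (x + 1)) ≠ ∞) ∧
      ∀ x, p ^ x * (visits q γ (Lead k (x + 1))).toReal = q ^ (x + 1) := by
  have hp : 0 < p := by linarith
  have := isProbabilityMeasure_drawLaw hq (by linarith) hγ₀ hγ₁
  have hQ := drawLaw_selfish (q := q) hγ₀ hγ₁
  have hP := drawLaw_honest (q := q) hγ₀ hγ₁
  rw [show 1 - q = p by linarith] at hP
  have hP₀ : ENNReal.ofReal p ≠ 0 := by simpa using hp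
  have hend := visits_start_succ (q := q) (γ := γ) k
  have hle : visits q γ (Secret (k + 1) 0) ≤ 1 := by
    rw [visits_start_eq_measure]
    exact prob_le_one
  have hstep := visits_lead_succ (q := q) (γ := γ) k
  have hone := visits_lead_one (q := q) (γ := γ) k
  have htie := visits_tie (q := q) (γ := γ) k
  rw [hk, hQ, one_mul] at hone
  rw [hP, hone] at htie
  rw [hQ, hP, htie, hk] at hend
  simp only [hQ, hP] at hstep
  -- Lead 2 is finite because it contributes with factor `p > 0` to a probability; the recurrence
  -- passes finiteness upwards.
  have hfin : ∀ x, visits q γ (Lead k (x + 1)) ≠ ∞ := by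
    have aux : ∀ a b c : ℝ≥0∞, a = b + c * ENNReal.ofReal p → a ≠ ∞ → c ≠ ∞ := by
      rintro a b c h ha rfl
      rw [ENNReal.top_mul hP₀, add_top] at h
      exact ha h
    intro x
    cases x with
    | zero => simp [hone]
    | succ x =>
      induction x with
      | zero =>
        intro h
        rw [h] at hend
        rw [hend] at hle
        simp [ENNReal.top_mul hP₀] at hle
      | succ x ih => exact aux _ _ _ (hstep x) ih
  have hend' := congrArg ENNReal.toReal hend
  have hQr := ENNReal.toReal_ofReal hq
  have hPr := ENNReal.toReal_ofReal hp.le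
  have hf2 := hfin 1
  rw [ENNReal.toReal_add (by finiteness) (by finiteness), ENNReal.toReal_mul, ENNReal.toReal_mul,
    ENNReal.toReal_mul, ENNReal.toReal_add (by finiteness) (by finiteness),
    ENNReal.toReal_add (by finiteness) (by finiteness), ENNReal.toReal_mul, hQr, hPr,
    ENNReal.toReal_one] at hend'
  have hle' := ENNReal.toReal_mono ENNReal.one_ne_top hle
  rw [ENNReal.toReal_one] at hle'
  -- The inequality `p * g 1 ≤ q ^ 2` is the bound by 1 on the probability of starting the next
  -- cycle, rearranged.
  have hg := green_function hpq hp hqp (g := fun x => (visits q γ (Lead k (x + 1))).toReal)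
    (fun x => ENNReal.toReal_nonneg) (by simp only [zero_add, hone, hQr]) (fun x => by
      have h₁ := hfin x
      have h₂ := hfin (x + 2)
      have := congrArg ENNReal.toReal (hstep x)
      rw [ENNReal.toReal_add (by finiteness) (by finiteness), ENNReal.toReal_mul,
        ENNReal.toReal_mul, hQr, hPr] at this
      simp only [this]
      ring) (by
      obtain rfl : p = 1 - q := by linarith
      simp only [Nat.reduceAdd]
      nlinarith)
  refine ⟨?_, hfin, hg⟩
  have h₁ := hg 1
  have h₂ : (visits q γ (Secret (k + 1) 0)).toReal = 1 := by
    rw [hend']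
    obtain rfl : p = 1 - q := by linarith
    simp only [Nat.reduceAdd, pow_one] at h₁
    linear_combination h₁
  rw [← ENNReal.toReal_one] at h₂
  exact (ENNReal.toReal_eq_toReal_iff' (ne_top_of_le_ne_top ENNReal.one_ne_top hle)
    ENNReal.one_ne_top).1 h₂

theorem visits_start (hpq : p + q = 1) (hq : 0 ≤ q) (hqp : q ≤ p) (hγ₀ : 0 ≤ γ) (hγ₁ : γ ≤ 1)
    (k : ℕ) : visits q γ (Secret k 0) = 1 := by
  induction k with
  | zero =>
    have := isProbabilityMeasure_drawLaw hq (by linarith) hγ₀ hγ₁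
    exact visits_start_zero
  | succ k ih => exact (visits_values hpq hq hqp hγ₀ hγ₁ ih).1

theorem ae_exists_starts (hpq : p + q = 1) (hq : 0 ≤ q) (hqp : q ≤ p) (hγ₀ : 0 ≤ γ) (hγ₁ : γ ≤ 1)
    (k : ℕ) : ∀ᵐ ω ∂historyLaw q γ, ∃ n, Starts ω k n := by
  have := isProbabilityMeasure_drawLaw hq (by linarith) hγ₀ hγ₁
  have h := visits_start hpq hq hqp hγ₀ hγ₁ k
  rw [visits_start_eq_measure] at h
  refine (mem_ae_iff_prob_eq_one ?_).2 h
  have : {ω | ∃ n, Starts ω k n} = ⋃ n, shapeEvent (Secret k 0) n := by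
    ext ω
    simp [shapeEvent_start]
  rw [this]
  exact MeasurableSet.iUnion fun n => (past_shapeEvent _ n).measurableSet

theorem visits_secret (hpq : p + q = 1) (hq : 0 ≤ q) (hqp : q ≤ p) (hγ₀ : 0 ≤ γ) (hγ₁ : γ ≤ 1)
    (k x : ℕ) : visits q γ (Secret k x) = ENNReal.ofReal q ^ x := by
  have := isProbabilityMeasure_drawLaw hq (by linarith) hγ₀ hγ₁
  induction x with
  | zero => simpa using visits_start hpq hq hqp hγ₀ hγ₁ k
  | succ x ih => rw [visits_secret_succ, ih, drawLaw_selfish hγ₀ hγ₁, pow_succ]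

/-! ## The final honest blocks of a cycle -/

/-- In cycle number `k` the attacker leads by `x` blocks and there is already an honest block. -/
def LeadPublic (k x c f a : ℕ) : Prop := c = k ∧ a ≠ 0 ∧ f = a + x

theorem visits_lead_eq (q γ : ℝ) (k x : ℕ) : visits q γ (Lead k x) =
    visits q γ (Secret k x) + visits q γ (LeadPublic k x) := by
  rw [← visits_or]
  · congr 1
    funext c f a
    simp only [Lead, Secret, LeadPublic, eq_iff_iff]
    omega
  · intro c f a
    simp only [Secret, LeadPublic]
    omega

/-- The switch matters only if an honest block is already present. Each piece is a past event, a
condition on draw `t` and a run of honest draws, so its probability factors. -/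
theorem tailBlock_eq (k m t : ℕ) : {ω | TailBlock k (m + 1) ω t} =
    ((shapeEvent (Secret k (m + 2)) t ∩ {ω | ω t ∈ minedBy Miner.honest}) ∪
      (shapeEvent (LeadPublic k (m + 2)) t ∩
        {ω | ω t ∈ {x : Draw | x.1 = Miner.honest ∧ x.2 = true}})) ∩
      {ω | ∀ i < m, ω (t + 1 + i) ∈ minedBy Miner.honest} := by
  ext ω
  have h : (∀ i < m + 1, (ω (t + i)).1 = Miner.honest) ↔
      (ω t).1 = Miner.honest ∧ ∀ i < m, (ω (t + 1 + i)).1 = Miner.honest := by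
    rw [Nat.forall_lt_succ_left]
    simp only [Nat.add_zero, Nat.add_assoc, Nat.add_comm 1]
  simp only [TailBlock, h, shapeEvent, Secret, LeadPublic, minedBy, Set.mem_ofPred_eq,
    Set.mem_inter_iff, Set.mem_union, ← List.length_eq_zero_iff]
  by_cases h₀ : (state ω t).pub.length = 0
  · simp only [h₀, Nat.zero_add]
    tauto
  · simp only [h₀]
    tauto

theorem measurableSet_tailBlock (k m t : ℕ) : MeasurableSet {ω | TailBlock k (m + 1) ω t} := by
  rw [tailBlock_eq]
  refine (((past_shapeEvent _ t).inter_draw _).union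
    ((past_shapeEvent _ t).inter_draw _)).measurableSet.inter ?_
  refine Past.measurableSet (n := t + 1 + m) fun ω ω' h h' i hi => ?_
  rw [← h _ (by omega)]
  exact h' i hi

theorem tsum_tailBlock (hpq : p + q = 1) (hq : 0 ≤ q) (hqp : q ≤ p) (hγ₀ : 0 ≤ γ) (hγ₁ : γ ≤ 1)
    (k m : ℕ) : ∑' t, historyLaw q γ {ω | TailBlock k (m + 1) ω t} =
      ENNReal.ofReal ((1 - γ) * (q * (p * q) ^ (m + 1)) + γ * q ^ (m + 2)) := by
  have hp : 0 < p := by linarith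
  have := isProbabilityMeasure_drawLaw hq (by linarith) hγ₀ hγ₁
  have hP := drawLaw_honest (q := q) hγ₀ hγ₁
  have hG := drawLaw_honest_onFork q γ
  rw [show 1 - q = p by linarith] at hP hG
  have h₁ : ∀ t, historyLaw q γ {ω | TailBlock k (m + 1) ω t} =
      historyLaw q γ (shapeEvent (Secret k (m + 2)) t) * ENNReal.ofReal p ^ (m + 1) +
      historyLaw q γ (shapeEvent (LeadPublic k (m + 2)) t) *
        (ENNReal.ofReal p ^ (m + 1) * ENNReal.ofReal γ) := by
    intro t
    rw [tailBlock_eq, (((past_shapeEvent _ t).inter_draw _).union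
      ((past_shapeEvent _ t).inter_draw _)).measure_inter_run, measure_union _
      ((past_shapeEvent _ t).inter_draw _).measurableSet, (past_shapeEvent _ t).measure_inter_draw,
      (past_shapeEvent _ t).measure_inter_draw, hP, hG]
    · ring
    · refine Set.disjoint_left.2 fun ω h₁ h₂ => ?_
      exact h₂.1.2.1 h₁.1.2.1
  simp only [h₁]
  rw [ENNReal.tsum_add, ENNReal.tsum_mul_right, ENNReal.tsum_mul_right, ← visits, ← visits]
  obtain ⟨-, hfin, hval⟩ := visits_values hpq hq hqp hγ₀ hγ₁ (visits_start hpq hq hqp hγ₀ hγ₁ k)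
  have hf := hfin (m + 1)
  have hv := hval (m + 1)
  have hs := visits_secret hpq hq hqp hγ₀ hγ₁ k (m + 2)
  rw [visits_lead_eq] at hf hv
  have hf' : visits q γ (LeadPublic k (m + 2)) ≠ ∞ := (ENNReal.add_ne_top.1 hf).2
  rw [ENNReal.toReal_add (by rw [hs]; finiteness) hf', hs, ENNReal.toReal_pow,
    ENNReal.toReal_ofReal hq] at hv
  rw [hs, ← ENNReal.ofReal_toReal hf', ← ENNReal.ofReal_pow hp.le, ← ENNReal.ofReal_pow hq,
    ← ENNReal.ofReal_mul (by positivity), ← ENNReal.ofReal_mul (by positivity),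
    ← ENNReal.ofReal_mul (by positivity), ← ENNReal.ofReal_add (by positivity) (by positivity)]
  congr 1
  -- `hv` gives the visits with an honest block as all visits minus the secret ones; only these
  -- carry the factor γ.
  linear_combination γ * hv

/-! ## The expectation -/

theorem TailBlock.lt {k m : ℕ} {ω : ℕ → Draw} {t e : ℕ} (h : TailBlock k m ω t)
    (he : Starts ω (k + 1) e) : t < e :=
  he.cycle_lt_iff.1 (by rw [h.1]; exact k.lt_succ_self)

theorem V_eq_tsum {n₁ k : ℕ} {ω : ℕ → Draw} {e e' : ℕ} (he : Starts ω (k + 1) e)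
    (he' : Starts ω (k + 2) e') : (V n₁ k ω : ℝ≥0∞) =
      ∑' t, ∑ m ∈ Finset.range (n₁ - 1), {ω | TailBlock k (m + 1) ω t}.indicator 1 ω := by
  rw [V_eq_ncard he he']
  set S := {t : ℕ | ∃ m, 1 ≤ m ∧ m + 1 ≤ n₁ ∧ TailBlock k m ω t} with hS
  have hfin : S.Finite := (Set.finite_Iio e).subset fun t ⟨m, _, _, h⟩ => h.lt he
  have h₁ : (S.ncard : ℝ≥0∞) = ∑' t, S.indicator 1 t := by
    rw [← tsum_subtype S (1 : ℕ → ℝ≥0∞)]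
    simp only [Pi.one_apply]
    rw [ENNReal.tsum_set_one, ← hfin.cast_ncard_eq]
    simp
  rw [h₁]
  congr 1
  ext t
  by_cases ht : t ∈ S
  · obtain ⟨m, hm, hmn, h⟩ := id ht
    -- The lead at time `t` determines `m`, so only one indicator is nonzero.
    rw [Set.indicator_of_mem ht, Finset.sum_eq_single (m - 1)]
    · rw [Set.indicator_of_mem]
      · rfl
      · rw [Set.mem_ofPred_eq, Nat.sub_add_cancel hm]
        exact h
    · intro i _ hi
      refine Set.indicator_of_notMem (s := {ω | TailBlock k (i + 1) ω t}) (fun h' => hi ?_) _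
      rw [Set.mem_ofPred_eq] at h'
      have e₁ := h.2.1
      have e₂ := h'.2.1
      omega
    · intro h'
      rw [Finset.mem_range] at h'
      omega
  · rw [Set.indicator_of_notMem ht, Finset.sum_eq_zero]
    intro i hi
    rw [Finset.mem_range] at hi
    refine Set.indicator_of_notMem (s := {ω | TailBlock k (i + 1) ω t}) (fun h' => ht ?_) _
    exact ⟨i + 1, by omega, by omega, h'⟩

end Values

end SelfishMining

theorem mainTheorem3 (p q γ : ℝ) (hpq : p + q = 1) (hq : 0 ≤ q) (hqp : q ≤ p)
    (hγ₀ : 0 ≤ γ) (hγ₁ : γ ≤ 1) (n₁ : ℕ) (hn₁ : 1 ≤ n₁) (k : ℕ) :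
    MeasureTheory.Integrable (fun ω => (SelfishMining.V n₁ k ω : ℝ))
        (SelfishMining.historyLaw q γ) ∧
      ∫ ω, (SelfishMining.V n₁ k ω : ℝ) ∂(SelfishMining.historyLaw q γ) =
        q ^ 2 / p * (1 - q ^ (n₁ - 1)) * γ +
          (1 - γ) * p * q ^ 2 * (1 - (p * q) ^ (n₁ - 1)) / (1 - p * q) := by
  open SelfishMining MeasureTheory in
  have hp : 0 < p := by linarith
  have hq₁ : q < 1 := by linarith
  have hpq₁ : p * q < 1 := by nlinarith
  have hmeas : ∀ t m, Measurable
      ({ω | TailBlock k (m + 1) ω t}.indicator (1 : (ℕ → Draw) → ENNReal)) :=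
    fun t m => measurable_one.indicator (measurableSet_tailBlock k m t)
  -- This gives almost everywhere measurability of `V` without examining its definition, and the sum
  -- can be integrated termwise.
  have hae : (fun ω => (V n₁ k ω : ENNReal)) =ᵐ[historyLaw q γ] fun ω =>
      ∑' t, ∑ m ∈ Finset.range (n₁ - 1), {ω | TailBlock k (m + 1) ω t}.indicator 1 ω := by
    filter_upwards [ae_exists_starts hpq hq hqp hγ₀ hγ₁ (k + 1),
      ae_exists_starts hpq hq hqp hγ₀ hγ₁ (k + 2)] with ω ⟨e, he⟩ ⟨e', he'⟩
    exact V_eq_tsum he he'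
  have hsm : ∀ t, Measurable fun ω =>
      ∑ m ∈ Finset.range (n₁ - 1),
        {ω | TailBlock k (m + 1) ω t}.indicator (1 : (ℕ → Draw) → ENNReal) ω :=
    fun t => Finset.measurable_fun_sum _ fun m _ => hmeas t m
  have hV : AEMeasurable (fun ω => (V n₁ k ω : ENNReal)) (historyLaw q γ) :=
    ⟨_, Measurable.tsum hsm, hae⟩
  have hterm : ∀ m, 0 ≤ (1 - γ) * (q * (p * q) ^ (m + 1)) + γ * q ^ (m + 2) := fun m => by
    have : 0 ≤ 1 - γ := by linarith
    positivity
  have hint : ∫⁻ ω, (V n₁ k ω : ENNReal) ∂historyLaw q γ = ENNReal.ofReal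
      (∑ m ∈ Finset.range (n₁ - 1), ((1 - γ) * (q * (p * q) ^ (m + 1)) + γ * q ^ (m + 2))) := by
    rw [lintegral_congr_ae hae, lintegral_tsum fun t => (hsm t).aemeasurable,
      ENNReal.ofReal_sum_of_nonneg fun m _ => hterm m]
    simp only [← tsum_tailBlock hpq hq hqp hγ₀ hγ₁ k]
    rw [← Summable.tsum_finsetSum fun _ _ => ENNReal.summable]
    congr 1
    ext t
    rw [lintegral_finsetSum _ fun m _ => hmeas t m]
    exact Finset.sum_congr rfl fun m _ => lintegral_indicator_one (measurableSet_tailBlock k m t)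
  have hcast : (fun ω => (V n₁ k ω : ℝ)) = fun ω => (V n₁ k ω : ENNReal).toReal := by
    ext ω
    rw [ENNReal.toReal_natCast]
  rw [hcast]
  refine ⟨integrable_toReal_of_lintegral_ne_top hV (by rw [hint]; exact ENNReal.ofReal_ne_top), ?_⟩
  rw [integral_toReal hV (Filter.Eventually.of_forall fun ω => ENNReal.natCast_lt_top _), hint,
    ENNReal.toReal_ofReal (Finset.sum_nonneg fun m _ => hterm m)]
  -- Applied to the ratios `p * q` and `q`; in the second case the denominator is `1 - q = p`.
  have hs : ∀ r : ℝ, r < 1 → ∑ m ∈ Finset.range (n₁ - 1), r ^ m = (1 - r ^ (n₁ - 1)) / (1 - r) := by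
    intro r hr
    rw [geom_sum_eq hr.ne, ← neg_div_neg_eq, neg_sub, neg_sub]
  have h₁ : ∀ m, (1 - γ) * (q * (p * q) ^ (m + 1)) + γ * q ^ (m + 2) =
      (1 - γ) * p * q ^ 2 * (p * q) ^ m + γ * q ^ 2 * q ^ m := fun m => by ring
  simp only [h₁]
  rw [Finset.sum_add_distrib, ← Finset.mul_sum, ← Finset.mul_sum, hs _ hpq₁, hs _ hq₁,
    show 1 - q = p by linarith]
  ring
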